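/- **Theorem (Reducing by one logical bit in $\mathsf{sympLPN}$).** *Setting.* Write $(a_1,b_1)\odot(a_2,b_2)=a_1\cdot b_2+a_2\cdot b_1$ for the symplectic inner product on $\mathbb Z_2^{2n}$. A matrix $A\in\mathbb Z_2^{2n\times k}$ is isotropic if its columns are pairwise orthogonal for $\odot$. The depolarizing distribution $\mathcal D_p^{\otimes n}$ on $e\in\mathbb Z_2^{2n}$ draws the pairs $(e_i,e_{n+i})$ independently; each is $(0,0)$ with probability $1-p$ and each of the three other values with probability $p/3$. Decision $\mathsf{sympLPN}(k,n,p)$ is the task of distinguishing a *structured* sample $(A,Ax+e)$ from an *unstructured* sample $(A,u)$, where $A\in\mathbb Z_2^{2n\times k}$ is a uniformly random full-rank isotropic matrix, and $x\in\mathbb Z_2^k$ uniform, $e\sim\mathcal D_p^{\otimes n}$, $u\in\mathbb Z_2^{2n}$ uniform are independent of $A$. For parameters $k=k(n)$, $p=p(n)$, a (possibly randomized) procedure *solves* it if its advantage $|\Pr[\text{answer "structured"}\mid\text{structured}]-\Pr[\text{answer "structured"}\mid\text{unstructured}]|$ is at least $n^{-c}$ for some constant $c$ and all sufficiently large $n$.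 Decision $\mathsf{sympLPN}(n,p)$ means Decision $\mathsf{sympLPN}(n,n,p)$. *Statement.* There is a classical randomized algorithm $M$ that makes a single oracle call and runs in time $\mathrm{poly}(n)$ on every instance $(A,u)\in\mathbb Z_2^{2n\times n}\times\mathbb Z_2^{2n}$ with $n\ge 2$, such that the following holds. Let $p=p(n)\in(0,1)$ be such that $\frac34-p=\Omega(1)$, i.e. there is a constant $c>0$ with $\frac34-p(n)\ge c$ for all sufficiently large $n$. Let $\mathcal O$ be any (possibly randomized) oracle that solves Decision $\mathsf{sympLPN}\bigl(n-1,\,n,\,p+\frac{\log_2^2 n}{n}\bigr)$. Then $M$ with oracle $\mathcal O$ solves Decision $\mathsf{sympLPN}(n,p)$. Here $M$ knows the parameters of the problem: besides $(A,u)$ it is given $n$ and the first $n$ binary digits of $p(n)$. It does not depend on $p$ or on $\mathcal O$ otherwise. Running time is counted on a random access machine with logarithmic cost, a programming language with bounded loops in which every arithmetic operation and memory access is charged the bit lengths involved. -/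

import Mathlib

open Filter

namespace SympLPN

/-! ## Symplectic vectors, codes and depolarizing noise

Positions `inl i` and `inr i` of a vector are its coordinates `i` and `n + i`; together they form
the `i`-th qubit pair. -/

/-- `ℤ₂^{2n}`. -/
abbrev Vec (n : ℕ) : Type := Fin n ⊕ Fin n → ZMod 2

/-- `ℤ₂^{2n × k}`. -/
abbrev Mat (n k : ℕ) : Type := Matrix (Fin n ⊕ Fin n) (Fin k) (ZMod 2)

/-- The symplectic inner product `(a₁, b₁) ⊙ (a₂, b₂) = a₁ · b₂ + a₂ · b₁` over `ℤ₂`. -/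
def sympInner {n : ℕ} (v w : Vec n) : ZMod 2 :=
  ∑ i, (v (Sum.inl i) * w (Sum.inr i) + w (Sum.inl i) * v (Sum.inr i))

/-- A matrix is isotropic if its columns are pairwise symplectically orthogonal. -/
def IsIsotropic {n k : ℕ} (A : Mat n k) : Prop :=
  ∀ i j, sympInner (fun r => A r i) (fun r => A r j) = 0

open Classical in
/-- The full-rank isotropic matrices in `ℤ₂^{2n × k}`. -/
noncomputable def codes (n k : ℕ) : Finset (Mat n k) :=
  Finset.univ.filter fun A => IsIsotropic A ∧ A.rank = k

/-- The probability of `e` under depolarizing noise with parameter `p`: the pairs are independent,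
each is `(0, 0)` with probability `1 - p`, and each other value has probability `p / 3`. -/
noncomputable def depolarizing {n : ℕ} (p : ℝ) (e : Vec n) : ℝ :=
  ∏ i, if e (Sum.inl i) = 0 ∧ e (Sum.inr i) = 0 then 1 - p else p / 3

/-! ## The decision problem

A randomized decision procedure on instances of size `(n, k)` is given by its probability
`D A u` of answering "structured" on the instance `(A, u)`. -/

/-- Probability of the answer "structured" on a random structured instance `(A, A x + e)`. -/
noncomputable def structuredProb (k n : ℕ) (p : ℝ) (D : Mat n k → Vec n → ℝ) : ℝ :=
  Finset.expect (codes n k) fun A =>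
    Finset.expect Finset.univ fun x : Fin k → ZMod 2 =>
      ∑ e : Vec n, depolarizing p e * D A (A.mulVec x + e)

/-- Probability of the answer "structured" on a random unstructured instance `(A, u)`. -/
noncomputable def unstructuredProb (k n : ℕ) (D : Mat n k → Vec n → ℝ) : ℝ :=
  Finset.expect (codes n k) fun A => Finset.expect Finset.univ fun u : Vec n => D A u

/-- The distinguishing advantage. -/
noncomputable def advantage (k n : ℕ) (p : ℝ) (D : Mat n k → Vec n → ℝ) : ℝ :=
  |structuredProb k n p D - unstructuredProb k n D|

/-- `D` solves Decision sympLPN with parameters `(k n, n, p n)`: it is a randomized decision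
procedure whose advantage is at least `1 / poly(n)` for all large `n`. -/
def Solves (k : ℕ → ℕ) (p : ℕ → ℝ) (D : (n : ℕ) → Mat n (k n) → Vec n → ℝ) : Prop :=
  (∀ n A u, D n A u ∈ Set.Icc (0 : ℝ) 1) ∧
    ∃ c : ℕ, ∀ᶠ n : ℕ in atTop, 1 / (n : ℝ) ^ c ≤ advantage (k n) n (p n) (D n)

/-! ## Programs and their running time

A random access machine with logarithmic cost, programmed in a structured language. The memory
consists of arrays of natural numbers, and every operation is charged the bit lengths of the numbers
that it handles. The only loops are bounded ones, so that every program halts; its running time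
can still be anything, and is counted by `Cmd.cost`. -/

/-- Memory: `s a i` is the content of cell `i` of array `a`. -/
abbrev Store : Type := ℕ → ℕ → ℕ

/-- Overwrite cell `i` of array `a` by `v`. -/
def Store.set (s : Store) (a i v : ℕ) : Store :=
  Function.update s a (Function.update (s a) i v)

/-- Arithmetic operations (subtraction is truncated, division is rounded down). -/
inductive ArithOp : Type
  | add | sub | mul | div | mod

/-- The value of an operation. -/
def ArithOp.eval : ArithOp → ℕ → ℕ → ℕ
  | .add, x, y => x + y
  | .sub, x, y => x - y
  | .mul, x, y => x * y
  | .div, x, y => x / y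
  | .mod, x, y => x % y

/-- Arithmetic terms: literals, the content of a cell with a computed address, operations. -/
inductive Arith : Type
  | lit (c : ℕ)
  | read (a : ℕ) (i : Arith)
  | op (o : ArithOp) (x y : Arith)

/-- The value of a term. -/
def Arith.eval (s : Store) : Arith → ℕ
  | .lit c => c
  | .read a i => s a (i.eval s)
  | .op o x y => o.eval (x.eval s) (y.eval s)

/-- The cost of evaluating a term: every node costs one plus the bit length of its value. -/
def Arith.cost (s : Store) : Arith → ℕ
  | .lit c => 1 + c.size
  | .read a i => 1 + (s a (i.eval s)).size + i.cost s
  | .op o x y => 1 + (o.eval (x.eval s) (y.eval s)).size + x.cost s + y.cost s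

/-- Programs: `write a i v` stores the value of `v` in cell `i` of array `a`; `ite e c d` runs `c`
if `e` is nonzero and `d` otherwise; `loop e c` evaluates `e` once and runs `c` that many times. -/
inductive Cmd : Type
  | skip
  | write (a : ℕ) (i v : Arith)
  | seq (c d : Cmd)
  | ite (e : Arith) (c d : Cmd)
  | loop (e : Arith) (c : Cmd)

/-- The memory after running a program. -/
def Cmd.run : Cmd → Store → Store
  | .skip, s => s
  | .write a i v, s => s.set a (i.eval s) (v.eval s)
  | .seq c d, s => d.run (c.run s)
  | .ite e c d, s => if e.eval s ≠ 0 then c.run s else d.run s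
  | .loop e c, s => (c.run)^[e.eval s] s

/-- The running time of a program. -/
def Cmd.cost : Cmd → Store → ℕ
  | .skip, _ => 1
  | .write _ i v, s => 1 + i.cost s + v.cost s
  | .seq c d, s => 1 + c.cost s + d.cost (c.run s)
  | .ite e c d, s => 1 + e.cost s + if e.eval s ≠ 0 then c.cost s else d.cost s
  | .loop e c, s =>
      1 + e.cost s + ∑ i ∈ Finset.range (e.eval s), (1 + c.cost ((c.run)^[i] s))

/-! ## Randomized algorithms with a single oracle call -/

/-- The array that holds a bit string (zero beyond its end). -/
def loadBits {m : ℕ} (v : Fin m → ZMod 2) : ℕ → ℕ :=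
  fun i => if h : i < m then (v ⟨i, h⟩).val else 0

/-- The bits of a vector: coordinate `inl i` is bit `i`, coordinate `inr i` is bit `n + i`. -/
def vecBits {n : ℕ} (v : Vec n) : Fin (n + n) → ZMod 2 :=
  fun t => v (finSumFinEquiv.symm t)

/-- The bits of a matrix, row by row: the entry in row `i`, column `j` is bit `i * k + j`. -/
def matBits {n k : ℕ} (A : Mat n k) : Fin ((n + n) * k) → ZMod 2 :=
  fun t => A (finSumFinEquiv.symm (finProdFinEquiv.symm t).1) (finProdFinEquiv.symm t).2

/-- The vector written in array `a`, in the layout of `vecBits` (a cell counts by its parity). -/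
def readVec (s : Store) (a n : ℕ) : Vec n :=
  fun i => (s a (finSumFinEquiv i : Fin (n + n)) : ZMod 2)

/-- The matrix written in array `a`, in the layout of `matBits` (a cell counts by its parity). -/
def readMat (s : Store) (a n k : ℕ) : Mat n k :=
  fun i j => (s a (finProdFinEquiv ((finSumFinEquiv i : Fin (n + n)), j) : Fin ((n + n) * k)) :
    ZMod 2)

/-- A randomized algorithm that makes exactly one oracle call: it tosses `coins.eval n` fair coins,
runs `pre` to prepare the query, receives the answer bit, and continues with `post`. -/
structure OneCallAlgorithm : Type where
  coins : Polynomial ℕ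
  pre : Cmd
  post : Cmd

namespace OneCallAlgorithm

variable (M : OneCallAlgorithm)

/-- The initial memory on an instance `(A, u)` of size `(n, n)`. Cell 0 of array 0 holds `n`, cell 0
of array 1 a number `P` that describes the noise rate, arrays 2 and 3 the instance, and array 4
the outcomes of the coin tosses. -/
def start (n P : ℕ) (A : Mat n n) (u : Vec n) (r : Fin (M.coins.eval n) → ZMod 2) : Store
  | 0 => fun i => if i = 0 then n else 0
  | 1 => fun i => if i = 0 then P else 0
  | 2 => loadBits (matBits A)
  | 3 => loadBits (vecBits u)
  | 4 => loadBits r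
  | _ => fun _ => 0

/-- The memory at the time of the oracle call. The query is the instance in arrays 5 and 6. -/
def atCall (n P : ℕ) (A : Mat n n) (u : Vec n) (r : Fin (M.coins.eval n) → ZMod 2) : Store :=
  M.pre.run (M.start n P A u r)

/-- The memory just after the oracle call: the answer bit (1 for "structured") is in cell 0 of
array 7, and nothing else has changed. -/
def answered (n P : ℕ) (A : Mat n n) (u : Vec n) (r : Fin (M.coins.eval n) → ZMod 2)
    (b : Bool) : Store :=
  (M.atCall n P A u r).set 7 0 b.toNat

/-- The algorithm answers "structured" (as 1, else 0) by leaving 1 in cell 0 of array 8. -/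
def output (n P : ℕ) (A : Mat n n) (u : Vec n) (r : Fin (M.coins.eval n) → ZMod 2)
    (b : Bool) : ℝ :=
  if M.post.run (M.answered n P A u r b) 8 0 = 1 then 1 else 0

/-- The probability, over the coins of the algorithm and the answer of the oracle `O`
(for instances of size `(n, n - 1)`), that the algorithm answers "structured". -/
noncomputable def acceptProb (n P : ℕ) (O : Mat n (n - 1) → Vec n → ℝ) (A : Mat n n) (u : Vec n) :
    ℝ :=
  Finset.expect Finset.univ fun r : Fin (M.coins.eval n) → ZMod 2 =>
    let q := O (readMat (M.atCall n P A u r) 5 n (n - 1)) (readVec (M.atCall n P A u r) 6 n)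
    q * M.output n P A u r true + (1 - q) * M.output n P A u r false

/-- The decision procedure obtained from an oracle. The real noise rate `p n` is made known to the
algorithm through its first `n` binary digits. -/
noncomputable def withOracle (p : ℕ → ℝ) (O : (n : ℕ) → Mat n (n - 1) → Vec n → ℝ) :
    (n : ℕ) → Mat n n → Vec n → ℝ :=
  fun n => M.acceptProb n ⌊2 ^ n * p n⌋₊ (O n)

/-- Polynomial running time in the worst case over instances, noise rates, coins and answers. -/
def IsPolyTime : Prop :=
  ∃ T : Polynomial ℕ, ∀ n P : ℕ, 2 ≤ n → P < 2 ^ n →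
    ∀ (A : Mat n n) (u : Vec n) (r : Fin (M.coins.eval n) → ZMod 2) (b : Bool),
      M.pre.cost (M.start n P A u r) + M.post.cost (M.answered n P A u r b) ≤ T.eval n

end OneCallAlgorithm

end SympLPN

namespace SympLPN

/-! ## Programs: frames, non-interference, loops -/

/-! Let `B` be `A` without its last column `a`. Symplectic elimination finds a vector `a'` (`pivot`)
orthogonal to the columns of `B` with `a' ⊙ a = 1`. The orthogonal complement of the code of `B`
modulo that code has four cosets, represented by `0`, `a`, `a'` and `a + a'`. Let `C v` be the
oracle's average answer on noisy codewords of `B` shifted by `v` (`cosetAverage`), and `U` its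
average on uniform vectors.

A structured `u` is a noisy codeword of `B` shifted by `0` or by `a`, each with probability 1/2. The
reduction adds further depolarizing noise and tosses a coin. With probability 1/2 it queries `u` and
returns the answer; with probability 1/4 it queries `u + a'` and negates the answer; otherwise it
returns 0. On a structured instance it accepts with probability `(C 0 + C a)/4 + 1/4 - (C a' + C (a
+ a'))/8`. A random code treats its three nontrivial cosets alike, so averaging over `A` gives `(C
a' + C (a + a'))/2` the value of `C a` (`expect_codes_shift`). What remains is `C 0 / 4 + 1/4`,
against `U/4 + 1/4` on unstructured instances. Since `B` is itself uniformly distributed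
(`expect_codes_dropLast`), the advantage is exactly a quarter of the oracle's, at the combined noise
rate (`advantage_algorithm`).

Noise rates `p` and `d` combine to `p + d - 4pd/3`, so the target `p + log₂² n / n` asks for `d = 3
log₂² n / (n (3 - 4p))`. The machine computes it in fixed point from logarithm series, up to an
error of order `n ^ 3 / 2 ^ n` (`abs_totalRate_sub_le`). A rate error `Δ` changes acceptance
probabilities by at most `n ^ 2 * Δ` (`abs_structuredProb_sub_le`), which is negligible.

Polynomial time comes from a decidable syntactic criterion (`Cmd.cost_le_of_tame`); correctness of
the program comes from loop invariants (`Cmd.for_inv`). -/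

@[simp] lemma Store.set_same (s : Store) (a i v : ℕ) : s.set a i v a i = v := by
  simp [Store.set]

@[simp] lemma Store.set_ne (s : Store) {a b : ℕ} (h : b ≠ a) (i v : ℕ) : s.set a i v b = s b := by
  simp [Store.set, h]

lemma Store.set_apply (s : Store) (a i v j : ℕ) :
    s.set a i v a j = if j = i then v else s a j := by
  simp [Store.set, Function.update_apply]

/-- The arrays that a program may write to. -/
def Cmd.writes : Cmd → List ℕ
  | .skip => []
  | .write a _ _ => [a]
  | .seq c d => c.writes ++ d.writes
  | .ite _ c d => c.writes ++ d.writes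
  | .loop _ c => c.writes

/-- The list `writes` is computed from the syntax, so for concrete programs the hypothesis is
settled by `decide`. -/
lemma Cmd.run_frame (c : Cmd) {a : ℕ} (h : a ∉ c.writes) (s : Store) : c.run s a = s a := by
  induction c generalizing s with
  | skip => rfl
  | write b i v =>
    simp only [Cmd.writes, List.mem_singleton] at h
    simp [Cmd.run, h]
  | seq c d hc hd =>
    simp only [Cmd.writes, List.mem_append, not_or] at h
    simp [Cmd.run, hc h.1, hd h.2]
  | ite e c d hc hd =>
    simp only [Cmd.writes, List.mem_append, not_or] at h
    simp only [Cmd.run]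
    split_ifs
    · exact hc h.1 s
    · exact hd h.2 s
  | loop e c hc =>
    simp only [Cmd.run]
    generalize e.eval s = m
    induction m generalizing s with
    | zero => rfl
    | succ m ih => rw [Function.iterate_succ_apply, ih, hc h]

/-- The arrays that a term reads. -/
def Arith.arrays : Arith → List ℕ
  | .lit _ => []
  | .read a i => a :: i.arrays
  | .op _ x y => x.arrays ++ y.arrays

/-- The arrays that a program reads or writes. -/
def Cmd.arrays : Cmd → List ℕ
  | .skip => []
  | .write a i v => a :: (i.arrays ++ v.arrays)
  | .seq c d => c.arrays ++ d.arrays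
  | .ite e c d => e.arrays ++ (c.arrays ++ d.arrays)
  | .loop e c => e.arrays ++ c.arrays

lemma Arith.eval_congr (e : Arith) {s t : Store} (h : ∀ a ∈ e.arrays, s a = t a) :
    e.eval s = e.eval t := by
  induction e with
  | lit c => rfl
  | read a i hi =>
    simp only [Arith.arrays, List.mem_cons, forall_eq_or_imp] at h
    simp [Arith.eval, h.1, hi h.2]
  | op o x y hx hy =>
    simp only [Arith.arrays, List.mem_append] at h
    simp [Arith.eval, hx fun a ha => h a (Or.inl ha), hy fun a ha => h a (Or.inr ha)]

/-- A program whose arrays belong to `R` maps stores that agree on `R` to stores that agree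
on `R`. -/
lemma Cmd.run_congr (c : Cmd) {R : ℕ → Prop} (hR : ∀ a ∈ c.arrays, R a) {s t : Store}
    (h : ∀ a, R a → s a = t a) : ∀ a, R a → c.run s a = c.run t a := by
  induction c generalizing s t with
  | skip => exact h
  | write b i v =>
    simp only [Cmd.arrays, List.mem_cons, List.mem_append, forall_eq_or_imp] at hR
    intro a ha
    have hi := i.eval_congr fun a ha => h a (hR.2 a (Or.inl ha))
    have hv := v.eval_congr fun a ha => h a (hR.2 a (Or.inr ha))
    by_cases hab : a = b
    · subst hab
      simp [Cmd.run, Store.set, hi, hv, h a ha]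
    · simp [Cmd.run, hab, h a ha]
  | seq c d hc hd =>
    simp only [Cmd.arrays, List.mem_append] at hR
    exact hd (fun a ha => hR a (Or.inr ha)) (hc (fun a ha => hR a (Or.inl ha)) h)
  | ite e c d hc hd =>
    simp only [Cmd.arrays, List.mem_append] at hR
    have he := e.eval_congr fun a ha => h a (hR a (Or.inl ha))
    simp only [Cmd.run, he]
    split_ifs
    · exact hc (fun a ha => hR a (Or.inr (Or.inl ha))) h
    · exact hd (fun a ha => hR a (Or.inr (Or.inr ha))) h
  | loop e c hc =>
    simp only [Cmd.arrays, List.mem_append] at hR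
    have he := e.eval_congr fun a ha => h a (hR a (Or.inl ha))
    simp only [Cmd.run, he]
    generalize e.eval t = m
    induction m generalizing s t with
    | zero => exact h
    | succ m ih =>
      simp only [Function.iterate_succ_apply]
      have h' := hc (fun a ha => hR a (Or.inr ha)) h
      exact ih h' (e.eval_congr fun a ha => h' a (hR a (Or.inl ha)))

/-- `for i < e do c`, with the counter `i` in cell 0 of array `k`. -/
def Cmd.for (k : ℕ) (e : Arith) (c : Cmd) : Cmd :=
  .seq (.write k (.lit 0) (.lit 0))
    (.loop e (.seq c (.write k (.lit 0) (.op .add (.read k (.lit 0)) (.lit 1)))))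

/-- The invariant rule for counting loops. -/
lemma Cmd.for_inv {k : ℕ} {e : Arith} {c : Cmd} (hk : k ∉ c.writes) (s : Store) {m : ℕ}
    (hm : e.eval (s.set k 0 0) = m) (I : ℕ → Store → Prop) (h0 : I 0 (s.set k 0 0))
    (hstep : ∀ i < m, ∀ t : Store, (∀ a, a ≠ k → a ∉ c.writes → t a = s a) → t k 0 = i → I i t →
      I (i + 1) ((c.run t).set k 0 (i + 1))) :
    I m ((Cmd.for k e c).run s) := by
  simp only [Cmd.for, Cmd.run, Arith.eval, hm]
  set f : Store → Store := fun t => (c.run t).set k 0 (ArithOp.add.eval (c.run t k 0) 1) with hf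
  have key : ∀ i ≤ m, (∀ a, a ≠ k → a ∉ c.writes → f^[i] (s.set k 0 0) a = s a) ∧
      f^[i] (s.set k 0 0) k 0 = i ∧ I i (f^[i] (s.set k 0 0)) := by
    intro i
    induction i with
    | zero => exact fun _ => ⟨fun a ha _ => by simp [ha], by simp, h0⟩
    | succ i ih =>
      intro hi
      obtain ⟨h1, h2, h3⟩ := ih (by omega)
      rw [Function.iterate_succ_apply']
      set t := f^[i] (s.set k 0 0)
      have ht : f t = (c.run t).set k 0 (i + 1) := by
        simp [hf, c.run_frame hk, h2, ArithOp.eval]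
      rw [ht]
      refine ⟨fun a ha hc => ?_, by simp, hstep i (by omega) t h1 h2 h3⟩
      simp [ha, c.run_frame hc, h1 a ha hc]
  exact (key m le_rfl).2.2

/-- `for i < e do a[i] := v`, with the counter `i` in cell 0 of array `k`. -/
def Cmd.fill (k a : ℕ) (e v : Arith) : Cmd := Cmd.for k e (.write a (.read k (.lit 0)) v)

/-- The value `v` may depend on the old content of the very cell that is overwritten, which covers
the in-place row updates of the elimination. -/
lemma Cmd.fill_run {k a : ℕ} {e v : Arith} (hk : k ≠ a) (s : Store) {m : ℕ}
    (hm : e.eval (s.set k 0 0) = m) (f : ℕ → ℕ)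
    (hv : ∀ i < m, ∀ t : Store, (∀ b, b ≠ k → b ≠ a → t b = s b) → t k 0 = i → t a i = s a i →
      v.eval t = f i) (j : ℕ) :
    (Cmd.fill k a e v).run s a j = if j < m then f j else s a j := by
  have := Cmd.for_inv (k := k) (e := e) (c := .write a (.read k (.lit 0)) v)
    (by simpa [Cmd.writes] using hk) s hm
    (fun i t => ∀ j, t a j = if j < i then f j else s a j)
    (by intro j; simp [hk.symm])
    (by
      intro i hi t ht hti hI j
      have hvt := hv i hi t (fun b hb hba => ht b hb (by simpa [Cmd.writes] using hba)) hti
        (by simpa using hI i)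
      rw [Store.set_ne _ hk.symm]
      simp only [Cmd.run, Arith.eval, hti, hvt, Store.set_apply, hI]
      by_cases hj : j = i
      · subst hj; simp
      · have : (j < i + 1) = (j < i) := by simp only [eq_iff_iff]; omega
        simp [hj, this])
  exact this j

/-! ## Running time

A program in which loop bounds depend on cell 0 of array 0 alone, and in which the numbers written
inside loops grow by a bounded number of bits only, runs in polynomial time. -/

/-- The term reads no cell other than cell 0 of array 0. -/
def Arith.fixed : Arith → Bool
  | .lit _ => true
  | .read a i => a == 0 && match i with
    | .lit 0 => true
    | _ => false
  | .op _ x y => x.fixed && y.fixed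

/-- The value of the term is longer than the numbers in memory by a bounded number of bits only. -/
def Arith.additive : Arith → Bool
  | .lit _ => true
  | .read _ _ => true
  | .op .add x y => x.additive && y.additive
  | .op .sub x _ => x.additive
  | .op .div x _ => x.additive
  | .op .mul _ _ => false
  -- A nonzero literal modulus bounds the result whatever `x` is; this admits products reduced mod 2
  -- inside loops.
  | .op .mod x y => x.additive || match y with
    | .lit (_ + 1) => true
    | _ => false

/-- All terms written to memory are additive. -/
def Cmd.additive : Cmd → Bool
  | .skip => true
  | .write a _ v => a != 0 && v.additive
  | .seq c d => c.additive && d.additive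
  | .ite _ c d => c.additive && d.additive
  | .loop e c => e.fixed && c.additive

/-- Array 0 is never written, and loops have fixed bounds and additive bodies. -/
def Cmd.tame : Cmd → Bool
  | .skip => true
  | .write a _ _ => a != 0
  | .seq c d => c.tame && d.tame
  | .ite _ c d => c.tame && d.tame
  | .loop e c => e.fixed && c.additive && c.tame

/-- All numbers in memory have at most `B` bits. -/
def Store.Small (B : ℕ) (s : Store) : Prop := ∀ a i, (s a i).size ≤ B

lemma Store.Small.mono {B C : ℕ} (h : B ≤ C) {s : Store} (hs : s.Small B) : s.Small C :=
  fun a i => (hs a i).trans h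

lemma Store.Small.set {B : ℕ} {s : Store} (hs : s.Small B) {a i v : ℕ} (hv : v.size ≤ B) :
    (s.set a i v).Small B := by
  intro b j
  by_cases hb : b = a
  · subst hb
    rw [Store.set_apply]
    split_ifs
    · exact hv
    · exact hs _ _
  · rw [Store.set_ne _ hb]
    exact hs b j

lemma _root_.Nat.size_add_le (x y : ℕ) : (x + y).size ≤ max x.size y.size + 1 := by
  rw [Nat.size_le, pow_succ]
  have hx := (Nat.lt_size_self x).trans_le
    (Nat.pow_le_pow_right two_pos (le_max_left x.size y.size))
  have hy := (Nat.lt_size_self y).trans_le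
    (Nat.pow_le_pow_right two_pos (le_max_right x.size y.size))
  omega

lemma _root_.Nat.size_mul_le (x y : ℕ) : (x * y).size ≤ x.size + y.size := by
  rw [Nat.size_le, pow_add]
  exact Nat.mul_lt_mul'' (Nat.lt_size_self x) (Nat.lt_size_self y)

lemma ArithOp.size_eval_le (o : ArithOp) (x y : ℕ) : (o.eval x y).size ≤ x.size + y.size + 1 := by
  cases o
  · have := Nat.size_add_le x y
    simp only [ArithOp.eval]
    omega
  · have := Nat.size_le_size (Nat.sub_le x y)
    simp only [ArithOp.eval]
    omega
  · have := Nat.size_mul_le x y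
    simp only [ArithOp.eval]
    omega
  · have := Nat.size_le_size (Nat.div_le_self x y)
    simp only [ArithOp.eval]
    omega
  · have := Nat.size_le_size (Nat.mod_le x y)
    simp only [ArithOp.eval]
    omega

lemma pow_le_pow_of_two_le {X a b : ℕ} (hX : 2 ≤ X) (h : a ≤ b) : X ^ a ≤ X ^ b :=
  Nat.pow_le_pow_right (by omega) h

/-- Three summands that are bounded by powers of `X ≥ 2`. -/
lemma add_three_le_pow {X a b c : ℕ} (hX : 2 ≤ X) :
    X ^ a + X ^ b + X ^ c ≤ X ^ (a + b + c + 2) := by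
  have ha := pow_le_pow_of_two_le hX (show a ≤ a + b + c by omega)
  have hb := pow_le_pow_of_two_le hX (show b ≤ a + b + c by omega)
  have hc := pow_le_pow_of_two_le hX (show c ≤ a + b + c by omega)
  have h4 : 4 ≤ X ^ 2 := by nlinarith
  rw [pow_add X (a + b + c) 2]
  nlinarith [Nat.zero_le (X ^ (a + b + c))]

lemma one_le_pow_of_two_le {X : ℕ} (hX : 2 ≤ X) (a : ℕ) : 1 ≤ X ^ a :=
  Nat.one_le_pow _ _ (by omega)

/-- All bounds in this part have the form `X ^ d` with `d` determined by the syntax alone. For `2 ≤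
X`, sums and products of such powers stay below another one. -/
lemma Arith.size_eval_le (e : Arith) : ∃ d, ∀ (X : ℕ) (s : Store), 2 ≤ X → s.Small X →
    (e.eval s).size ≤ X ^ d := by
  induction e with
  | lit c =>
    refine ⟨c.size, fun X s hX _ => ?_⟩
    exact (Nat.lt_pow_self (by omega)).le
  | read a i _ => exact ⟨1, fun X s _ hs => by simpa [Arith.eval] using hs a _⟩
  | op o x y hx hy =>
    obtain ⟨d, hd⟩ := hx
    obtain ⟨d', hd'⟩ := hy
    refine ⟨d + d' + 0 + 2, fun X s hX hs => ?_⟩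
    have := add_three_le_pow (a := d) (b := d') (c := 0) hX
    have h1 := hd X s hX hs
    have h2 := hd' X s hX hs
    have h3 := o.size_eval_le (x.eval s) (y.eval s)
    simp only [Arith.eval]
    rw [pow_zero] at this
    omega

lemma Arith.cost_le (e : Arith) : ∃ d, ∀ (X : ℕ) (s : Store), 2 ≤ X → s.Small X →
    e.cost s ≤ X ^ d := by
  induction e with
  | lit c =>
    refine ⟨1 + c.size, fun X s hX _ => (Nat.lt_pow_self (by omega)).le⟩
  | read a i hi =>
    obtain ⟨d, hd⟩ := hi
    refine ⟨0 + 1 + d + 2, fun X s hX hs => ?_⟩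
    have := add_three_le_pow (a := 0) (b := 1) (c := d) hX
    have h1 := hd X s hX hs
    have h2 := hs a (i.eval s)
    simp only [Arith.cost]
    rw [pow_zero, pow_one] at this
    omega
  | op o x y hx hy =>
    obtain ⟨d1, h1⟩ := hx
    obtain ⟨d2, h2⟩ := hy
    obtain ⟨d3, h3⟩ := (Arith.op o x y).size_eval_le
    refine ⟨d1 + d2 + (d3 + 0 + 0 + 2) + 2, fun X s hX hs => ?_⟩
    have := add_three_le_pow (a := d1) (b := d2) (c := d3 + 0 + 0 + 2) hX
    have h4 := add_three_le_pow (a := d3) (b := 0) (c := 0) hX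
    have h1 := h1 X s hX hs
    have h2 := h2 X s hX hs
    have h3 := h3 X s hX hs
    simp only [Arith.cost]
    simp only [Arith.eval, pow_zero] at *
    omega

/-- Loop counts need a bound on the value and not just on its bit length. It is available because
the only number read is `s 0 0`. -/
lemma Arith.eval_le_of_fixed (e : Arith) (he : e.fixed = true) :
    ∃ d, ∀ (X : ℕ) (s : Store), 2 ≤ X → s 0 0 ≤ X → e.eval s ≤ X ^ d := by
  induction e with
  | lit c => exact ⟨c, fun X s hX _ => (Nat.lt_pow_self (by omega)).le⟩
  | read a i _ =>
    refine ⟨1, fun X s _ hs => ?_⟩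
    simp only [Arith.fixed, Bool.and_eq_true, beq_iff_eq] at he
    obtain ⟨rfl, h⟩ := he
    split at h
    · simpa [Arith.eval] using hs
    · simp at h
  | op o x y hx hy =>
    simp only [Arith.fixed, Bool.and_eq_true] at he
    obtain ⟨d1, h1⟩ := hx he.1
    obtain ⟨d2, h2⟩ := hy he.2
    refine ⟨d1 + d2 + 0 + 2, fun X s hX hs => ?_⟩
    have h := add_three_le_pow (a := d1) (b := d2) (c := 0) hX
    have h1 := h1 X s hX hs
    have h2 := h2 X s hX hs
    have hm : X ^ d1 * X ^ d2 ≤ X ^ (d1 + d2 + 0 + 2) := by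
      rw [← pow_add]; exact pow_le_pow_of_two_le hX (by omega)
    cases o
    · simp only [Arith.eval, ArithOp.eval]; omega
    · simp only [Arith.eval, ArithOp.eval]; omega
    · exact (Nat.mul_le_mul h1 h2).trans hm
    · have := Nat.div_le_self (x.eval s) (y.eval s)
      simp only [Arith.eval, ArithOp.eval]; omega
    · have := Nat.mod_le (x.eval s) (y.eval s)
      simp only [Arith.eval, ArithOp.eval]; omega

lemma Arith.size_eval_le_of_additive (e : Arith) (he : e.additive = true) :
    ∃ k, ∀ (B : ℕ) (s : Store), s.Small B → (e.eval s).size ≤ B + k := by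
  induction e with
  | lit c => exact ⟨c.size, fun B s _ => by simp [Arith.eval]⟩
  | read a i _ => exact ⟨0, fun B s hs => hs _ _⟩
  | op o x y hx hy =>
    cases o
    · simp only [Arith.additive, Bool.and_eq_true] at he
      obtain ⟨k1, h1⟩ := hx he.1
      obtain ⟨k2, h2⟩ := hy he.2
      refine ⟨k1 + k2 + 1, fun B s hs => ?_⟩
      have := Nat.size_add_le (x.eval s) (y.eval s)
      have := h1 B s hs
      have := h2 B s hs
      simp only [Arith.eval, ArithOp.eval]
      omega
    · simp only [Arith.additive] at he
      obtain ⟨k1, h1⟩ := hx he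
      exact ⟨k1, fun B s hs => (Nat.size_le_size (Nat.sub_le _ _)).trans (h1 B s hs)⟩
    · simp [Arith.additive] at he
    · simp only [Arith.additive] at he
      obtain ⟨k1, h1⟩ := hx he
      exact ⟨k1, fun B s hs => (Nat.size_le_size (Nat.div_le_self _ _)).trans (h1 B s hs)⟩
    · simp only [Arith.additive, Bool.or_eq_true] at he
      rcases he with he | he
      · obtain ⟨k1, h1⟩ := hx he
        exact ⟨k1, fun B s hs => (Nat.size_le_size (Nat.mod_le _ _)).trans (h1 B s hs)⟩
      · split at he
        · rename_i c
          refine ⟨(c + 1).size, fun B s hs => ?_⟩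
          have := Nat.size_le_size (Nat.mod_lt (x.eval s) (Nat.succ_pos c)).le
          simp only [Arith.eval, ArithOp.eval, Nat.succ_eq_add_one] at *
          omega
        · simp at he

lemma Cmd.run_zero_of_tame (c : Cmd) (h : c.tame = true) (s : Store) : c.run s 0 = s 0 := by
  refine c.run_frame ?_ s
  induction c with
  | skip => simp [Cmd.writes]
  | write a i v =>
    simp only [Cmd.tame, bne_iff_ne, ne_eq] at h
    simpa [Cmd.writes] using fun h' => h h'.symm
  | seq c d hc hd =>
    simp only [Cmd.tame, Bool.and_eq_true] at h
    simp [Cmd.writes, hc h.1, hd h.2]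
  | ite e c d hc hd =>
    simp only [Cmd.tame, Bool.and_eq_true] at h
    simp [Cmd.writes, hc h.1, hd h.2]
  | loop e c hc =>
    simp only [Cmd.tame, Bool.and_eq_true] at h
    exact hc h.2

lemma Cmd.tame_of_additive (c : Cmd) (h : c.additive = true) : c.tame = true := by
  induction c with
  | skip => rfl
  | write a i v =>
    simp only [Cmd.additive, Bool.and_eq_true] at h
    exact h.1
  | seq c d hc hd =>
    simp only [Cmd.additive, Bool.and_eq_true] at h
    simp [Cmd.tame, hc h.1, hd h.2]
  | ite e c d hc hd =>
    simp only [Cmd.additive, Bool.and_eq_true] at h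
    simp [Cmd.tame, hc h.1, hd h.2]
  | loop e c hc =>
    simp only [Cmd.additive, Bool.and_eq_true] at h
    simp [Cmd.tame, h.1, h.2, hc h.2]

lemma Cmd.iterate_zero_of_tame (c : Cmd) (h : c.tame = true) (s : Store) (i : ℕ) :
    (c.run)^[i] s 0 = s 0 := by
  induction i with
  | zero => rfl
  | succ i ih => rw [Function.iterate_succ_apply', c.run_zero_of_tame h, ih]

/-- The increment `K` does not depend on `B`, so the growth is linear in the number of iterations.
Growth by a factor would become exponential. -/
lemma Store.Small.iterate {X K B : ℕ} {c : Cmd} (hc : c.tame = true)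
    (h : ∀ (s : Store) (B : ℕ), s 0 0 ≤ X → s.Small B → (c.run s).Small (B + K)) {s : Store}
    (h0 : s 0 0 ≤ X) (hs : s.Small B) (i : ℕ) : ((c.run)^[i] s).Small (B + i * K) := by
  induction i with
  | zero => simpa using hs
  | succ i ih =>
    rw [Function.iterate_succ_apply']
    refine (h _ _ ?_ ih).mono (by rw [Nat.succ_mul]; omega)
    rwa [c.iterate_zero_of_tame hc]

/-- The form `B + X ^ d` survives nesting: a loop multiplies the increment by its count, which is
itself at most a power of `X`. -/
lemma Cmd.small_run_of_additive (c : Cmd) (h : c.additive = true) :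
    ∃ d, ∀ (X : ℕ) (s : Store) (B : ℕ), 2 ≤ X → s 0 0 ≤ X → s.Small B →
      (c.run s).Small (B + X ^ d) := by
  induction c with
  | skip => exact ⟨0, fun X s B _ _ hs => hs.mono (by omega)⟩
  | write a i v =>
    simp only [Cmd.additive, Bool.and_eq_true] at h
    obtain ⟨k, hk⟩ := v.size_eval_le_of_additive h.2
    refine ⟨k, fun X s B hX _ hs => (hs.mono (by omega)).set ?_⟩
    have : k < X ^ k := Nat.lt_pow_self (by omega)
    have := hk B s hs
    omega
  | seq c d hc hd =>
    simp only [Cmd.additive, Bool.and_eq_true] at h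
    obtain ⟨d1, h1⟩ := hc h.1
    obtain ⟨d2, h2⟩ := hd h.2
    refine ⟨d1 + d2 + 0 + 2, fun X s B hX h0 hs => ?_⟩
    have := add_three_le_pow (a := d1) (b := d2) (c := 0) hX
    refine (h2 X _ _ hX ?_ (h1 X s B hX h0 hs)).mono (by omega)
    rwa [c.run_zero_of_tame (c.tame_of_additive h.1)]
  | ite e c d hc hd =>
    simp only [Cmd.additive, Bool.and_eq_true] at h
    obtain ⟨d1, h1⟩ := hc h.1
    obtain ⟨d2, h2⟩ := hd h.2
    refine ⟨d1 + d2 + 0 + 2, fun X s B hX h0 hs => ?_⟩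
    have := add_three_le_pow (a := d1) (b := d2) (c := 0) hX
    simp only [Cmd.run]
    split_ifs
    · exact (h1 X s B hX h0 hs).mono (by omega)
    · exact (h2 X s B hX h0 hs).mono (by omega)
  | loop e c hc =>
    simp only [Cmd.additive, Bool.and_eq_true] at h
    obtain ⟨d1, h1⟩ := e.eval_le_of_fixed h.1
    obtain ⟨d2, h2⟩ := hc h.2
    refine ⟨d1 + d2, fun X s B hX h0 hs => ?_⟩
    refine (Store.Small.iterate (c.tame_of_additive h.2) (fun t C ht hC => h2 X t C hX ht hC) h0 hs
      (e.eval s)).mono ?_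
    rw [pow_add]
    exact Nat.add_le_add_left (Nat.mul_le_mul_right _ (h1 X s hX h0)) _

/-- Outside loops the number of commands is fixed, so polynomial growth may be composed and
exponents multiply. The condition `1 ≤ d` gives `X ≤ X ^ d`, so the bound on cell 0 of array 0
persists when `X ^ d` takes the place of `X`. -/
lemma Cmd.small_run_of_tame (c : Cmd) (h : c.tame = true) :
    ∃ d, 1 ≤ d ∧ ∀ (X : ℕ) (s : Store), 2 ≤ X → s 0 0 ≤ X → s.Small X →
      (c.run s).Small (X ^ d) := by
  induction c with
  | skip => exact ⟨1, le_rfl, fun X s _ _ hs => by simpa [Cmd.run] using hs⟩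
  | write a i v =>
    obtain ⟨d, hd⟩ := v.size_eval_le
    refine ⟨d + 1, by omega, fun X s hX _ hs => (hs.mono ?_).set ((hd X s hX hs).trans ?_)⟩
    · simpa using pow_le_pow_of_two_le hX (show 1 ≤ d + 1 by omega)
    · exact pow_le_pow_of_two_le hX (by omega)
  | seq c d hc hd =>
    simp only [Cmd.tame, Bool.and_eq_true] at h
    obtain ⟨d1, hd1, h1⟩ := hc h.1
    obtain ⟨d2, hd2, h2⟩ := hd h.2
    refine ⟨d1 * d2, Nat.mul_pos hd1 hd2, fun X s hX h0 hs => ?_⟩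
    have hX1 : X ≤ X ^ d1 := by simpa using pow_le_pow_of_two_le hX hd1
    rw [pow_mul]
    refine h2 (X ^ d1) _ (hX.trans hX1) ?_ (h1 X s hX h0 hs)
    rw [c.run_zero_of_tame h.1]
    exact h0.trans hX1
  | ite e c d hc hd =>
    simp only [Cmd.tame, Bool.and_eq_true] at h
    obtain ⟨d1, hd1, h1⟩ := hc h.1
    obtain ⟨d2, hd2, h2⟩ := hd h.2
    refine ⟨d1 + d2, by omega, fun X s hX h0 hs => ?_⟩
    simp only [Cmd.run]
    split_ifs
    · exact (h1 X s hX h0 hs).mono (pow_le_pow_of_two_le hX (by omega))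
    · exact (h2 X s hX h0 hs).mono (pow_le_pow_of_two_le hX (by omega))
  | loop e c hc =>
    simp only [Cmd.tame, Bool.and_eq_true] at h
    obtain ⟨d, hd⟩ := Cmd.small_run_of_additive (.loop e c) (by simp [Cmd.additive, h.1])
    refine ⟨1 + d + 0 + 2, by omega, fun X s hX h0 hs => (hd X s X hX h0 hs).mono ?_⟩
    have := add_three_le_pow (a := 1) (b := d) (c := 0) hX
    rw [pow_one] at this
    omega

/-- Tame programs run in polynomial time. -/
lemma Cmd.cost_le_of_tame (c : Cmd) (h : c.tame = true) :
    ∃ d, ∀ (X : ℕ) (s : Store), 2 ≤ X → s 0 0 ≤ X → s.Small X → c.cost s ≤ X ^ d := by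
  induction c with
  | skip => exact ⟨0, fun X s _ _ _ => by simp [Cmd.cost]⟩
  | write a i v =>
    obtain ⟨d1, h1⟩ := i.cost_le
    obtain ⟨d2, h2⟩ := v.cost_le
    refine ⟨0 + d1 + d2 + 2, fun X s hX _ hs => ?_⟩
    have := add_three_le_pow (a := 0) (b := d1) (c := d2) hX
    have := h1 X s hX hs
    have := h2 X s hX hs
    simp only [Cmd.cost, pow_zero] at *
    omega
  | seq c d hc hd =>
    simp only [Cmd.tame, Bool.and_eq_true] at h
    obtain ⟨d1, h1⟩ := hc h.1
    obtain ⟨d2, h2⟩ := hd h.2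
    obtain ⟨d3, hd3, h3⟩ := c.small_run_of_tame h.1
    refine ⟨0 + d1 + d3 * d2 + 2, fun X s hX h0 hs => ?_⟩
    have := add_three_le_pow (a := 0) (b := d1) (c := d3 * d2) hX
    have := h1 X s hX h0 hs
    have hX3 : X ≤ X ^ d3 := by simpa using pow_le_pow_of_two_le hX hd3
    have := h2 (X ^ d3) (c.run s) (hX.trans hX3)
      (by rw [c.run_zero_of_tame h.1]; exact h0.trans hX3) (h3 X s hX h0 hs)
    rw [← pow_mul] at this
    simp only [Cmd.cost, pow_zero] at *
    omega
  | ite e c d hc hd =>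
    simp only [Cmd.tame, Bool.and_eq_true] at h
    obtain ⟨d1, h1⟩ := hc h.1
    obtain ⟨d2, h2⟩ := hd h.2
    obtain ⟨d3, h3⟩ := e.cost_le
    refine ⟨0 + d3 + (d1 + d2) + 2, fun X s hX h0 hs => ?_⟩
    have := add_three_le_pow (a := 0) (b := d3) (c := d1 + d2) hX
    have := (h1 X s hX h0 hs).trans (pow_le_pow_of_two_le hX (show d1 ≤ d1 + d2 by omega))
    have := (h2 X s hX h0 hs).trans (pow_le_pow_of_two_le hX (show d2 ≤ d1 + d2 by omega))
    have := h3 X s hX hs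
    simp only [Cmd.cost, pow_zero] at *
    split_ifs <;> omega
  | loop e c hc =>
    simp only [Cmd.tame, Bool.and_eq_true] at h
    obtain ⟨d1, h1⟩ := hc h.2
    obtain ⟨d2, h2⟩ := e.cost_le
    obtain ⟨d3, h3⟩ := e.eval_le_of_fixed h.1.1
    obtain ⟨d4, h4⟩ := c.small_run_of_additive h.1.2
    set D := 1 + (d3 + d4) + 0 + 2 with hD
    refine ⟨0 + d2 + (d3 + (0 + 0 + D * d1 + 2)) + 2, fun X s hX h0 hs => ?_⟩
    have key : ∀ i ∈ Finset.range (e.eval s), 1 + c.cost ((c.run)^[i] s) ≤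
        X ^ (0 + 0 + D * d1 + 2) := by
      intro i hi
      have hi' : i ≤ X ^ d3 := (Finset.mem_range.1 hi).le.trans (h3 X s hX h0)
      have hsm : ((c.run)^[i] s).Small (X ^ D) := by
        refine (Store.Small.iterate h.2 (fun t C ht hC => h4 X t C hX ht hC) h0 hs i).mono ?_
        have := add_three_le_pow (a := 1) (b := d3 + d4) (c := 0) hX
        have hmul := Nat.mul_le_mul_right (X ^ d4) hi'
        rw [← pow_add] at hmul
        rw [pow_one, pow_zero, ← hD] at this
        omega
      have hXD : X ≤ X ^ D := by simpa using pow_le_pow_of_two_le hX (show 1 ≤ D by omega)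
      have := h1 (X ^ D) ((c.run)^[i] s) (hX.trans hXD)
        (by rw [c.iterate_zero_of_tame h.2]; exact h0.trans hXD) hsm
      rw [← pow_mul] at this
      have h5 := add_three_le_pow (a := 0) (b := 0) (c := D * d1) hX
      simp only [pow_zero] at h5
      omega
    have hsum := Finset.sum_le_card_nsmul _ _ _ key
    rw [Finset.card_range, smul_eq_mul] at hsum
    have hmul := Nat.mul_le_mul_right (X ^ (0 + 0 + D * d1 + 2)) (h3 X s hX h0)
    rw [← pow_add] at hmul
    have := add_three_le_pow (a := 0) (b := d2) (c := d3 + (0 + 0 + D * d1 + 2)) hX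
    have := h2 X s hX hs
    simp only [Cmd.cost, pow_zero] at *
    omega

lemma loadBits_le_one {m : ℕ} (v : Fin m → ZMod 2) (i : ℕ) : loadBits v i ≤ 1 := by
  unfold loadBits
  split_ifs
  · exact Nat.lt_succ_iff.1 (ZMod.val_lt _)
  · omega

lemma _root_.Nat.size_le_one_of_le {x : ℕ} (h : x ≤ 1) : x.size ≤ 1 := by
  rw [Nat.size_le]; omega

lemma OneCallAlgorithm.small_start (M : OneCallAlgorithm) {n P : ℕ} (hn : 2 ≤ n) (hP : P < 2 ^ n)
    (A : Mat n n) (u : Vec n) (r : Fin (M.coins.eval n) → ZMod 2) :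
    (M.start n P A u r).Small n := by
  have hb : ∀ {m : ℕ} (v : Fin m → ZMod 2) (i : ℕ), (loadBits v i).size ≤ n := fun v i =>
    (Nat.size_le_one_of_le (loadBits_le_one v i)).trans (by omega)
  intro a i
  unfold OneCallAlgorithm.start
  split
  · dsimp only
    split_ifs
    · exact Nat.size_le.2 Nat.lt_two_pow_self
    · simp
  · dsimp only
    split_ifs
    · exact Nat.size_le.2 hP
    · simp
  · exact hb _ _
  · exact hb _ _
  · exact hb _ _
  · simp

/-- An algorithm that consists of tame programs runs in polynomial time. -/
lemma OneCallAlgorithm.isPolyTime_of_tame (M : OneCallAlgorithm) (hpre : M.pre.tame = true)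
    (hpost : M.post.tame = true) : M.IsPolyTime := by
  obtain ⟨d1, h1⟩ := M.pre.cost_le_of_tame hpre
  obtain ⟨d2, hd2, h2⟩ := M.pre.small_run_of_tame hpre
  obtain ⟨d3, h3⟩ := M.post.cost_le_of_tame hpost
  refine ⟨Polynomial.X ^ d1 + Polynomial.X ^ (d2 * d3), fun n P hn hP A u r b => ?_⟩
  have hs := M.small_start hn hP A u r
  have h0 : M.start n P A u r 0 0 ≤ n := by simp [OneCallAlgorithm.start]
  have hX : n ≤ n ^ d2 := by simpa using pow_le_pow_of_two_le hn hd2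
  have hpost := h3 (n ^ d2) (M.answered n P A u r b) (hn.trans hX)
    (by
      unfold OneCallAlgorithm.answered OneCallAlgorithm.atCall
      rw [Store.set_ne _ (by norm_num), M.pre.run_zero_of_tame hpre]
      exact h0.trans hX)
    ((h2 n _ hn h0 hs).set ((Nat.size_le_one_of_le (by cases b <;> simp)).trans
      (one_le_pow_of_two_le hn d2)))
  rw [← pow_mul] at hpost
  simpa using Nat.add_le_add (h1 n _ hn h0 hs) hpost

/-! ## The symplectic inner product -/

lemma sympInner_comm {n : ℕ} (v w : Vec n) : sympInner v w = sympInner w v := by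
  simp only [sympInner]
  exact Finset.sum_congr rfl fun i _ => by ring

lemma sympInner_add_left {n : ℕ} (v v' w : Vec n) :
    sympInner (v + v') w = sympInner v w + sympInner v' w := by
  simp only [sympInner, Pi.add_apply, ← Finset.sum_add_distrib]
  exact Finset.sum_congr rfl fun i _ => by ring

lemma sympInner_smul_left {n : ℕ} (c : ZMod 2) (v w : Vec n) :
    sympInner (c • v) w = c * sympInner v w := by
  simp only [sympInner, Pi.smul_apply, smul_eq_mul, Finset.mul_sum]
  exact Finset.sum_congr rfl fun i _ => by ring

lemma sympInner_add_right {n : ℕ} (v w w' : Vec n) :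
    sympInner v (w + w') = sympInner v w + sympInner v w' := by
  simp only [sympInner_comm v, sympInner_add_left]

lemma sympInner_smul_right {n : ℕ} (c : ZMod 2) (v w : Vec n) :
    sympInner v (c • w) = c * sympInner v w := by
  simp only [sympInner_comm v, sympInner_smul_left]

lemma sympInner_self {n : ℕ} (v : Vec n) : sympInner v v = 0 := by
  simp only [sympInner, CharTwo.add_self_eq_zero, Finset.sum_const_zero]

@[simp] lemma sympInner_zero_right {n : ℕ} (v : Vec n) : sympInner v 0 = 0 := by
  simp [sympInner]

/-- The vector whose bits, in the layout of `vecBits`, are the parities of `f 0, f 1, …`. -/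
def vecOf (n : ℕ) (f : ℕ → ℕ) : Vec n := fun i => (f (finSumFinEquiv i : Fin (n + n)) : ZMod 2)

/-- The symplectic partner of position `x` is `(x + n) % (n + n)`. In this form the inner product is
a single loop. -/
lemma sympInner_vecOf (n : ℕ) (f g : ℕ → ℕ) :
    sympInner (vecOf n f) (vecOf n g) =
      ∑ x ∈ Finset.range (n + n), ((f x * g ((x + n) % (n + n)) : ℕ) : ZMod 2) := by
  rw [Finset.sum_range_add, ← Fin.sum_univ_eq_sum_range, ← Fin.sum_univ_eq_sum_range,
    ← Finset.sum_add_distrib]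
  refine Finset.sum_congr rfl fun i _ => ?_
  have h1 : ((i : ℕ) + n) % (n + n) = n + i := by
    rw [Nat.mod_eq_of_lt (by omega), add_comm]
  have h2 : (n + (i : ℕ) + n) % (n + n) = i := by
    rw [show n + (i : ℕ) + n = i + (n + n) by ring, Nat.add_mod_right, Nat.mod_eq_of_lt (by omega)]
  simp only [vecOf, finSumFinEquiv_apply_left, finSumFinEquiv_apply_right, Fin.val_castAdd,
    Fin.val_natAdd, h1, h2, Nat.cast_mul]
  ring

/-- Nondegeneracy: the unit vector at the partner of a position reads off the coordinate at that
position. -/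
lemma eq_zero_of_sympInner_single {n : ℕ} (z : Vec n)
    (h : ∀ k < n + n, sympInner (vecOf n fun x => if k = x then 1 else 0) z = 0) : z = 0 := by
  have hz : z = vecOf n (loadBits (vecBits z)) := by
    funext i
    simp [vecOf, loadBits, vecBits]
  funext i
  set y : ℕ := ((finSumFinEquiv i : Fin (n + n)) : ℕ) with hy
  have hyn : y < n + n := (finSumFinEquiv i).2
  have hk : (y + n) % (n + n) < n + n := Nat.mod_lt _ (by omega)
  have := h _ hk
  rw [hz, sympInner_vecOf, Finset.sum_eq_single ((y + n) % (n + n))] at this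
  · rw [Nat.mod_add_mod, show y + n + n = y + (n + n) by ring, Nat.add_mod_right,
      Nat.mod_eq_of_lt hyn] at this
    rw [hz]
    simpa [vecOf, ← hy] using this
  · intro b _ hb
    simp [hb.symm]
  · intro hb
    simp [hk] at hb

/-! ## Layout of vectors and matrices in memory -/

lemma readVec_eq (s : Store) (a n : ℕ) : readVec s a n = vecOf n (s a) := rfl

lemma vecOf_loadBits {n : ℕ} (u : Vec n) : vecOf n (loadBits (vecBits u)) = u := by
  funext i
  simp [vecOf, loadBits, vecBits]

lemma vecOf_congr {n : ℕ} {f g : ℕ → ℕ} (h : ∀ i < n + n, f i = g i) : vecOf n f = vecOf n g := by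
  funext i
  simp [vecOf, h _ (finSumFinEquiv i).2]

lemma loadBits_matBits {n k : ℕ} (A : Mat n k) (i : Fin n ⊕ Fin n) (j : Fin k) :
    loadBits (matBits A) ((finSumFinEquiv i : Fin (n + n)) * k + j) = (A i j).val := by
  have hval : ((finSumFinEquiv i : Fin (n + n)) * k + j : ℕ) =
      (finProdFinEquiv ((finSumFinEquiv i : Fin (n + n)), j) : Fin ((n + n) * k)) := by
    simp [finProdFinEquiv]; ring
  rw [hval]
  simp only [loadBits, Fin.is_lt, dif_pos, Fin.eta, matBits, Equiv.symm_apply_apply]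

lemma vecOf_column {n k : ℕ} (A : Mat n k) (j : Fin k) :
    vecOf n (fun x => loadBits (matBits A) (x * k + j)) = fun i => A i j := by
  funext i
  simp [vecOf, loadBits_matBits]

/-! ## The algorithm -/

instance : Add Arith := ⟨.op .add⟩
instance : Sub Arith := ⟨.op .sub⟩
instance : Mul Arith := ⟨.op .mul⟩
instance : Div Arith := ⟨.op .div⟩
instance : Mod Arith := ⟨.op .mod⟩
instance (k : ℕ) : OfNat Arith k := ⟨.lit k⟩

namespace Arith

variable (s : Store)

@[simp] lemma eval_add (x y : Arith) : (x + y).eval s = x.eval s + y.eval s := rfl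
@[simp] lemma eval_sub (x y : Arith) : (x - y).eval s = x.eval s - y.eval s := rfl
@[simp] lemma eval_mul (x y : Arith) : (x * y).eval s = x.eval s * y.eval s := rfl
@[simp] lemma eval_div (x y : Arith) : (x / y).eval s = x.eval s / y.eval s := rfl
@[simp] lemma eval_mod (x y : Arith) : (x % y).eval s = x.eval s % y.eval s := rfl
@[simp] lemma eval_ofNat (k : ℕ) : (no_index (OfNat.ofNat k) : Arith).eval s = k := rfl
@[simp] lemma eval_read (a : ℕ) (i : Arith) : (read a i).eval s = s a (i.eval s) := rfl

/-- The content of cell 0 of array `a`. -/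
def var (a : ℕ) : Arith := .read a 0

@[simp] lemma eval_var (a : ℕ) : (var a).eval s = s a 0 := rfl

end Arith

namespace Reduction

open Arith

/-- The number of qubits. -/
def N : Arith := var 0

@[simp] lemma eval_N (s : Store) : N.eval s = s 0 0 := rfl

/-- Array 5 receives all columns but the last of the matrix. -/
def copyMatrix : Cmd :=
  .fill 31 5 ((N + N) * (N - 1)) (.read 2 (var 31 / (N - 1) * N + var 31 % (N - 1)))

/-- Array 11 receives the syndromes of the rows of array 10 with respect to column `var 13` of the
matrix, and `var 17` the index of a row with nonzero syndrome, if there is one. -/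
def syndromes : Cmd :=
  .for 14 (N + N) <|
    .seq (.write 16 0 0) <|
    .seq (.for 15 (N + N) (.write 16 0 ((var 16 +
      .read 10 (var 14 * (N + N) + var 15) *
        .read 2 ((var 15 + N) % (N + N) * N + var 13)) % 2))) <|
    .seq (.write 11 (var 14) (var 16)) <|
    .ite (var 16) (.write 17 0 (var 14)) .skip

/-- Array 12 receives a vector that is orthogonal to all columns of the matrix but the last. -/
def eliminate : Cmd :=
  -- With truncated subtraction, `1 - (i - j) - (j - i)` is 1 if `i = j` and 0 otherwise: array 10
  -- starts as the identity matrix.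
  .seq (.fill 9 10 ((N + N) * (N + N)) (1 - (var 9 / (N + N) - var 9 % (N + N)) -
    (var 9 % (N + N) - var 9 / (N + N)))) <|
  .for 13 N <|
    .seq syndromes <|
    -- The pivot row is copied out first, since the update adds it to every row of nonzero syndrome,
    -- itself included, and so erases it.
    .seq (.fill 9 12 (N + N) (.read 10 (var 17 * (N + N) + var 9))) <|
    .fill 9 10 ((N + N) * (N + N)) ((.read 10 (var 9) +
      .read 11 (var 9 / (N + N)) * .read 12 (var 9 % (N + N))) % 2)

/-- The rate of the additional noise in terms of fixed-point values of `2 ^ n`, `log n`, `log 2`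
and `p`. -/
def rate (n W a b P : ℕ) : ℕ := 4 * W * W * (a * a) / (n * (b * b) * (3 * W - 4 * P))

/-- `var 25` receives the rate of the additional noise. -/
def computeRate : Cmd :=
  .seq (.write 18 0 1) <|
  .seq (.for 9 N (.write 18 0 (var 18 + var 18))) <|
  .seq (.write 20 0 0) <|
  .seq (.for 22 (N - 1) <|
    .seq (.write 21 0 (var 18)) <|
    .seq (.for 23 N <|
      .seq (.write 21 0 (var 21 / (var 22 + 2)))
        (.write 20 0 (var 20 + var 21 / (var 23 + 1)))) <|
    -- After the round with counter 0 the accumulated sum approximates `2 ^ n * log 2`; it is kept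
    -- as the denominator of the base-2 logarithm.
    .ite (var 22) .skip (.write 24 0 (var 20))) <|
  .write 25 0 (4 * var 18 * var 18 * (var 20 * var 20) /
    (N * (var 24 * var 24) * (3 * var 18 - 4 * var 1)))

/-- Array 30 receives the additional noise. -/
def sampleNoise : Cmd :=
  .for 26 N <|
    .seq (.write 27 0 0) <|
    .seq (.for 28 N (.write 27 0 (var 27 + var 27 + .read 4 (var 26 * (N + 2) + var 28)))) <|
    -- By truncation this is 1 if `var 27 < var 25` and 0 otherwise.
    .seq (.write 29 0 (1 - (1 - (var 25 - var 27)))) <|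
    .seq (.write 30 (var 26) (var 29 * .read 4 (var 26 * (N + 2) + N) % 2)) <|
    .write 30 (N + var 26) (var 29 * .read 4 (var 26 * (N + 2) + N + 1) % 2)

/-- Array 6 receives the noisy vector, shifted by a logical operator on the toss of a coin. -/
def prepareVector : Cmd :=
  .fill 9 6 (N + N) (.read 3 (var 9) + .read 30 (var 9) +
    .read 4 (N * (N + 2)) * .read 12 (var 9) % 2)

/-- Depending on two coins, the answer is used, is negated, or is replaced by 0. -/
def answer : Cmd :=
  .write 8 0 ((1 - .read 4 (N * (N + 2))) * var 7 +
    .read 4 (N * (N + 2)) * ((1 - .read 4 (N * (N + 2) + 1)) * (1 - var 7)))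

/-- The reduction. -/
noncomputable def algorithm : OneCallAlgorithm where
  coins := Polynomial.X * (Polynomial.X + 2) + 2
  pre := .seq copyMatrix <| .seq eliminate <| .seq computeRate <| .seq sampleNoise prepareVector
  post := answer

lemma isPolyTime_algorithm : algorithm.IsPolyTime :=
  algorithm.isPolyTime_of_tame rfl rfl

open Arith

/-! ### Elimination -/

/-- Row `k` of the square matrix in array 10. -/
def row (n : ℕ) (t : Store) (k : ℕ) : Vec n := vecOf n fun x => t 10 (k * (n + n) + x)

/-- Column `c` of the matrix in array 2. -/
def column (n : ℕ) (t : Store) (c : ℕ) : Vec n := vecOf n fun x => t 2 (x * n + c)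

lemma syndromes_run {n c : ℕ} (s : Store) (hn : s 0 0 = n) (hc : s 13 0 = c) :
    (∀ k < n + n, ((syndromes.run s 11 k : ℕ) : ZMod 2) = sympInner (row n s k) (column n s c)) ∧
      ((∃ k < n + n, sympInner (row n s k) (column n s c) ≠ 0) →
        syndromes.run s 17 0 < n + n ∧
          sympInner (row n s (syndromes.run s 17 0)) (column n s c) ≠ 0) := by
  have hrow : ∀ t : Store, t 10 = s 10 → ∀ k, row n t k = row n s k := by
    intro t ht k; simp only [row, ht]
  refine Cmd.for_inv (by simp [Cmd.writes, Cmd.for]) s (m := n + n) (by simp [hn])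
    (fun i t => (∀ k < i, ((t 11 k : ℕ) : ZMod 2) = sympInner (row n s k) (column n s c)) ∧
      ((∃ k < i, sympInner (row n s k) (column n s c) ≠ 0) → t 17 0 < n + n ∧
          sympInner (row n s (t 17 0)) (column n s c) ≠ 0)) (by simp) ?_
  intro i hi t ht hti hI
  have h0 : t 0 = s 0 := ht 0 (by norm_num) (by simp [Cmd.writes, Cmd.for])
  have h2 : t 2 = s 2 := ht 2 (by norm_num) (by simp [Cmd.writes, Cmd.for])
  have h10 : t 10 = s 10 := ht 10 (by norm_num) (by simp [Cmd.writes, Cmd.for])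
  have h13 : t 13 = s 13 := ht 13 (by norm_num) (by simp [Cmd.writes, Cmd.for])
  set inner : Cmd := .for 15 (N + N) (.write 16 0 ((var 16 +
      .read 10 (var 14 * (N + N) + var 15) *
        .read 2 ((var 15 + N) % (N + N) * N + var 13)) % 2)) with hinner
  obtain ⟨hlt, key⟩ : inner.run (t.set 16 0 0) 16 0 < 2 ∧
      ((inner.run (t.set 16 0 0) 16 0 : ℕ) : ZMod 2) =
        ∑ x ∈ Finset.range (n + n),
          ((s 10 (i * (n + n) + x) * s 2 ((x + n) % (n + n) * n + c) : ℕ) : ZMod 2) := by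
    rw [hinner]
    refine Cmd.for_inv (by simp [Cmd.writes]) (t.set 16 0 0) (m := n + n) (by simp [h0, hn])
      (fun m t' => t' 16 0 < 2 ∧ ((t' 16 0 : ℕ) : ZMod 2) =
        ∑ x ∈ Finset.range m,
          ((s 10 (i * (n + n) + x) * s 2 ((x + n) % (n + n) * n + c) : ℕ) : ZMod 2))
      (by simp) ?_
    intro m hm t' ht' htm hI'
    have e : ∀ a, a ≠ 15 → a ≠ 16 → t' a = t a := fun a ha hb => by
      rw [ht' a ha (by simpa [Cmd.writes] using hb), Store.set_ne _ hb]
    simp only [Cmd.run, eval_mod, eval_add, eval_mul, eval_read, eval_var, eval_N, eval_ofNat,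
      Store.set_same, Store.set_ne _ (show (16 : ℕ) ≠ 15 by norm_num), e 10 (by norm_num)
      (by norm_num), e 2 (by norm_num) (by norm_num), e 0 (by norm_num) (by norm_num),
      e 13 (by norm_num) (by norm_num), e 14 (by norm_num) (by norm_num), htm, h0, h2, h10, h13, hn,
      hc, hti, ZMod.natCast_mod, Finset.sum_range_succ, ← hI'.2, Nat.cast_add]
    exact ⟨Nat.mod_lt _ two_pos, trivial⟩
  have hfr : ∀ a, a ≠ 15 → a ≠ 16 → inner.run (t.set 16 0 0) a = t a := fun a ha hb => by
    rw [Cmd.run_frame _ (by simp [hinner, Cmd.writes, Cmd.for, ha, hb]), Store.set_ne _ hb]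
  have hrow' := sympInner_vecOf n (fun x => s 10 (i * (n + n) + x)) (fun x => s 2 (x * n + c))
  rw [← key] at hrow'
  change sympInner (row n s i) (column n s c) = _ at hrow'
  set t1 := inner.run (t.set 16 0 0) with ht1
  have hrun : ∀ d : Cmd, (Cmd.seq (.write 16 0 0) (.seq inner d)).run t = d.run t1 := fun d => rfl
  rw [hrun]
  have h11 : t1 11 = t 11 := hfr 11 (by norm_num) (by norm_num)
  have h14 : t1 14 0 = i := by rw [hfr 14 (by norm_num) (by norm_num), hti]
  have h17 : t1 17 = t 17 := hfr 17 (by norm_num) (by norm_num)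
  by_cases hz : t1 16 0 = 0
  · rw [hz, Nat.cast_zero] at hrow'
    have e11 : ∀ k, (((Cmd.write 11 (var 14) (var 16)).seq
        (.ite (var 16) (.write 17 0 (var 14)) .skip)).run t1).set 14 0 (i + 1) 11 k =
          if k = i then 0 else t 11 k := by
      intro k
      simp [Cmd.run, h14, hz, h11, Store.set_apply]
    have e17 : (((Cmd.write 11 (var 14) (var 16)).seq
        (.ite (var 16) (.write 17 0 (var 14)) .skip)).run t1).set 14 0 (i + 1) 17 = t 17 := by
      simp [Cmd.run, hz, h17]
    simp only [e11, e17]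
    refine ⟨fun k hk => ?_, ?_⟩
    · by_cases hki : k = i
      · simp [hki, hrow']
      · simp [hki, hI.1 k (by omega)]
    · rintro ⟨k, hk, hne⟩
      have hki : k ≠ i := by rintro rfl; exact hne hrow'
      exact hI.2 ⟨k, by omega, hne⟩
  · have e11 : ∀ k, (((Cmd.write 11 (var 14) (var 16)).seq
        (.ite (var 16) (.write 17 0 (var 14)) .skip)).run t1).set 14 0 (i + 1) 11 k =
          if k = i then t1 16 0 else t 11 k := by
      intro k
      simp [Cmd.run, h14, hz, h11, Store.set_apply]
    have e17 : (((Cmd.write 11 (var 14) (var 16)).seq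
        (.ite (var 16) (.write 17 0 (var 14)) .skip)).run t1).set 14 0 (i + 1) 17 0 = i := by
      simp [Cmd.run, hz, h14]
    simp only [e11, e17]
    refine ⟨fun k hk => ?_, fun _ => ⟨hi, ?_⟩⟩
    · by_cases hki : k = i
      · simp [hki, hrow']
      · simp [hki, hI.1 k (by omega)]
    · rw [hrow', show t1 16 0 = 1 by omega]
      simp

/-- If the last column is not in the span of the others, then the elimination finds a vector that
is orthogonal to all columns but the last. -/
lemma eliminate_run {n : ℕ} (s : Store) (hn : s 0 0 = n) (t : Store) (ht : t = eliminate.run s) :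
    ∀ c0, n = c0 + 1 →
      column n s c0 ∉ Submodule.span (ZMod 2) (column n s '' Set.Iio c0) →
      (∀ c' < c0, sympInner (vecOf n (t 12)) (column n s c') = 0) ∧
        sympInner (vecOf n (t 12)) (column n s c0) = 1 := by
  set s1 := (Cmd.fill 9 10 ((N + N) * (N + N)) (1 - (var 9 / (N + N) - var 9 % (N + N)) -
    (var 9 % (N + N) - var 9 / (N + N)))).run s with hs1
  have hs1a : ∀ a, a ≠ 9 → a ≠ 10 → s1 a = s a := fun a ha hb => by
    rw [hs1, Cmd.run_frame _ (by simp [Cmd.writes, Cmd.for, Cmd.fill, ha, hb])]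
  have hs1row : ∀ k < n + n, row n s1 k = vecOf n fun x => if k = x then 1 else 0 := by
    intro k hk
    refine vecOf_congr fun x hx => ?_
    have hlt : k * (n + n) + x < (n + n) * (n + n) := by nlinarith
    have hdiv : (k * (n + n) + x) / (n + n) = k := by
      rw [mul_comm, Nat.mul_add_div (by omega), Nat.div_eq_of_lt hx, add_zero]
    have hmod : (k * (n + n) + x) % (n + n) = x := by
      rw [mul_comm, Nat.mul_add_mod, Nat.mod_eq_of_lt hx]
    rw [hs1, Cmd.fill_run (by norm_num) s (m := (n + n) * (n + n)) (by simp [hn])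
      (fun i => 1 - (i / (n + n) - i % (n + n)) - (i % (n + n) - i / (n + n))), if_pos hlt, hdiv,
      hmod]
    · split_ifs <;> omega
    · intro i _ t ht hti _
      simp [hti, ht 0, hn]
  have hrun : eliminate.run s = (Cmd.for 13 N <| .seq syndromes <|
    .seq (.fill 9 12 (N + N) (.read 10 (var 17 * (N + N) + var 9))) <|
    .fill 9 10 ((N + N) * (N + N)) ((.read 10 (var 9) +
      .read 11 (var 9 / (N + N)) * .read 12 (var 9 % (N + N))) % 2)).run s1 := rfl
  have hcol : ∀ t : Store, t 2 = s 2 → ∀ k, column n t k = column n s k := by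
    intro t ht k; simp only [column, ht]
  -- The invariant after `c` columns: the rows are orthogonal to these columns, and whatever is
  -- orthogonal to all rows lies in the span of these columns. So the rows span the orthogonal
  -- complement. A new column outside the span of its predecessors must therefore meet some row with
  -- nonzero syndrome, and that row is the vector sought.
  suffices h : (∀ k < n + n, ∀ c' < n, sympInner (row n t k) (column n s c') = 0) ∧
      (∀ z, (∀ k < n + n, sympInner (row n t k) z = 0) →
        z ∈ Submodule.span (ZMod 2) (column n s '' Set.Iio n)) ∧
      ∀ c0, n = c0 + 1 →
      column n s c0 ∉ Submodule.span (ZMod 2) (column n s '' Set.Iio c0) →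
      (∀ c' < c0, sympInner (vecOf n (t 12)) (column n s c') = 0) ∧
        sympInner (vecOf n (t 12)) (column n s c0) = 1 from h.2.2
  rw [ht, hrun]
  refine Cmd.for_inv (by decide) s1 (m := n) (by simp [hs1a 0, hn])
    (fun c t => (∀ k < n + n, ∀ c' < c, sympInner (row n t k) (column n s c') = 0) ∧
      (∀ z, (∀ k < n + n, sympInner (row n t k) z = 0) →
        z ∈ Submodule.span (ZMod 2) (column n s '' Set.Iio c)) ∧
      ∀ c0, c = c0 + 1 →
      column n s c0 ∉ Submodule.span (ZMod 2) (column n s '' Set.Iio c0) →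
      (∀ c' < c0, sympInner (vecOf n (t 12)) (column n s c') = 0) ∧
        sympInner (vecOf n (t 12)) (column n s c0) = 1) ?_ ?_
  · refine ⟨by simp, fun z hz => ?_, by simp⟩
    have : z = 0 := eq_zero_of_sympInner_single z fun k hk => by
      rw [← hs1row k hk]
      exact hz k hk
    simp [this]
  intro c hc t ht htc ⟨I1, I2, _⟩
  have h0 : t 0 0 = n := by
    rw [ht 0 (by norm_num) (by decide), hs1a 0 (by norm_num) (by norm_num), hn]
  have h2 : t 2 = s 2 := by rw [ht 2 (by norm_num) (by decide), hs1a 2 (by norm_num) (by norm_num)]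
  obtain ⟨S1, S2⟩ := syndromes_run t h0 htc
  rw [hcol t h2] at S1 S2
  set t1 := syndromes.run t with ht1
  have f1 : ∀ a, a ∉ syndromes.writes → t1 a = t a := fun a ha => Cmd.run_frame _ ha _
  set t2 := (Cmd.fill 9 12 (N + N) (.read 10 (var 17 * (N + N) + var 9))).run t1 with ht2
  have f2 : ∀ a, a ≠ 9 → a ≠ 12 → t2 a = t1 a := fun a ha hb => by
    rw [ht2, Cmd.run_frame _ (by simp [Cmd.writes, Cmd.for, Cmd.fill, ha, hb])]
  set t3 := (Cmd.fill 9 10 ((N + N) * (N + N)) ((.read 10 (var 9) +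
      .read 11 (var 9 / (N + N)) * .read 12 (var 9 % (N + N))) % 2)).run t2 with ht3
  have f3 : ∀ a, a ≠ 9 → a ≠ 10 → t3 a = t2 a := fun a ha hb => by
    rw [ht3, Cmd.run_frame _ (by simp [Cmd.writes, Cmd.for, Cmd.fill, ha, hb])]
  have h10 : t1 0 0 = n := by rw [f1 0 (by decide), h0]
  have h20 : t2 0 0 = n := by rw [f2 0 (by norm_num) (by norm_num), h10]
  have hp : vecOf n (t3 12) = row n t (t1 17 0) := by
    rw [f3 12 (by norm_num) (by norm_num)]
    refine vecOf_congr fun x hx => ?_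
    rw [ht2, Cmd.fill_run (by norm_num) t1 (m := n + n) (by simp [h10])
      (fun i => t 10 (t1 17 0 * (n + n) + i)), if_pos hx]
    intro i _ t' ht' hti _
    simp [ht' 0, ht' 17, ht' 10, h10, hti, f1 10 (by decide)]
  have hr : ∀ k < n + n, row n t3 k =
      row n t k + sympInner (row n t k) (column n s c) • vecOf n (t3 12) := by
    intro k hk
    funext i
    set x : ℕ := ((finSumFinEquiv i : Fin (n + n)) : ℕ) with hx'
    have hx : x < n + n := (finSumFinEquiv i).2
    have hlt : k * (n + n) + x < (n + n) * (n + n) := by nlinarith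
    have hdiv : (k * (n + n) + x) / (n + n) = k := by
      rw [mul_comm, Nat.mul_add_div (by omega), Nat.div_eq_of_lt hx, add_zero]
    have hmod : (k * (n + n) + x) % (n + n) = x := by
      rw [mul_comm, Nat.mul_add_mod, Nat.mod_eq_of_lt hx]
    have : t3 10 (k * (n + n) + x) = (t 10 (k * (n + n) + x) + t1 11 k * t3 12 x) % 2 := by
      rw [ht3, Cmd.fill_run (by norm_num) t2 (m := (n + n) * (n + n)) (by simp [h20])
        (fun i => (t 10 i + t1 11 (i / (n + n)) * t3 12 (i % (n + n))) % 2), if_pos hlt, hdiv,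
        hmod]
      intro i _ t' ht' hti hta
      simp [ht' 0, ht' 11, ht' 12, h20, hti, f2 11, f2 10, f1 10 (by decide), hta,
        f3 12 (by norm_num) (by norm_num)]
    simp only [row, vecOf, Pi.add_apply, Pi.smul_apply, smul_eq_mul, ← hx', this, ZMod.natCast_mod,
      Nat.cast_add, Nat.cast_mul]
    rw [S1 k hk]
    rfl
  have hgoal : ((Cmd.seq syndromes <|
    .seq (.fill 9 12 (N + N) (.read 10 (var 17 * (N + N) + var 9))) <|
    .fill 9 10 ((N + N) * (N + N)) ((.read 10 (var 9) +
      .read 11 (var 9 / (N + N)) * .read 12 (var 9 % (N + N))) % 2)).run t) = t3 := rfl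
  rw [hgoal]
  have hrow' : ∀ k, row n (t3.set 13 0 (c + 1)) k = row n t3 k := fun k => by simp [row]
  simp only [hrow', Store.set_ne _ (show (12 : ℕ) ≠ 13 by norm_num)]
  have hpiv : (∃ k < n + n, sympInner (row n t k) (column n s c) ≠ 0) →
      (∀ c' < c, sympInner (vecOf n (t3 12)) (column n s c') = 0) ∧
        sympInner (vecOf n (t3 12)) (column n s c) = 1 := by
    intro hex
    obtain ⟨h1, h2⟩ := S2 hex
    rw [hp]
    exact ⟨I1 _ h1, Fin.eq_one_of_ne_zero _ h2⟩
  refine ⟨fun k hk c' hc' => ?_, fun z hz => ?_, ?_⟩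
  · rw [hr k hk, sympInner_add_left, sympInner_smul_left]
    by_cases hs : sympInner (row n t k) (column n s c) = 0
    · rw [hs, zero_mul, add_zero]
      rcases Nat.lt_succ_iff_lt_or_eq.1 hc' with h | rfl
      · exact I1 k hk c' h
      · exact hs
    · obtain ⟨h1, h2⟩ := hpiv ⟨k, hk, hs⟩
      rcases Nat.lt_succ_iff_lt_or_eq.1 hc' with h | rfl
      · rw [I1 k hk c' h, h1 c' h, mul_zero, add_zero]
      · rw [h2, mul_one, CharTwo.add_self_eq_zero]
  · have hmono : Submodule.span (ZMod 2) (column n s '' Set.Iio c) ≤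
        Submodule.span (ZMod 2) (column n s '' Set.Iio (c + 1)) :=
      Submodule.span_mono (Set.image_mono (Set.Iio_subset_Iio (by omega)))
    have hmem : column n s c ∈ Submodule.span (ZMod 2) (column n s '' Set.Iio (c + 1)) :=
      Submodule.subset_span ⟨c, by simp, rfl⟩
    -- If `z` is orthogonal to the updated rows, then moving the pivot's contribution to the other
    -- argument shows that `z + (pivot ⊙ z) • column c` is orthogonal to the old rows.
    have := hmono (I2 (z + sympInner (vecOf n (t3 12)) z • column n s c) fun k hk => by
      have := hz k hk
      rw [hr k hk, sympInner_add_left, sympInner_smul_left] at this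
      rw [sympInner_add_right, sympInner_smul_right, ← this]
      ring)
    exact (Submodule.add_mem_iff_left _ (Submodule.smul_mem _ _ hmem)).1 this
  · rintro c0 hc0 hnot
    obtain rfl : c = c0 := by omega
    refine hpiv ?_
    by_contra! hall
    exact hnot (I2 _ hall)

open Arith

/-! ### The noise rate -/

/-- `2 ^ n * log (j + 2)`, approximately. -/
def fixedLog (n j : ℕ) : ℕ :=
  ∑ k ∈ Finset.range n, 2 ^ n / (j + 2) ^ (k + 1) / (k + 1)

/-- The rate of the additional noise. -/
def noiseRate (n P : ℕ) : ℕ :=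
  rate n (2 ^ n) (∑ j ∈ Finset.range (n - 1), fixedLog n j) (fixedLog n 0) P

/-- The hypothesis `2 ≤ n` makes the outer loop run at least once, so that `var 24` has been
written. -/
lemma computeRate_run {n : ℕ} (hn : 2 ≤ n) (s : Store) (h0 : s 0 0 = n) :
    computeRate.run s 25 0 = noiseRate n (s 1 0) := by
  set s1 := (Cmd.for 9 N (.write 18 0 (var 18 + var 18))).run (s.set 18 0 1) with hs1
  have f1 : ∀ a, a ≠ 9 → a ≠ 18 → s1 a = s a := fun a ha hb => by
    rw [hs1, Cmd.run_frame _ (by simp [Cmd.writes, Cmd.for, ha, hb]), Store.set_ne _ hb]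
  have hpow : s1 18 0 = 2 ^ n := by
    rw [hs1]
    refine Cmd.for_inv (by decide) (s.set 18 0 1) (m := n) (by simp [h0])
      (fun i t => t 18 0 = 2 ^ i) (by simp) ?_
    intro i _ t _ _ hI
    simp [Cmd.run, hI, pow_succ]
    ring
  set outer : Cmd := .for 22 (N - 1) <|
    .seq (.write 21 0 (var 18)) <|
    .seq (.for 23 N <|
      .seq (.write 21 0 (var 21 / (var 22 + 2)))
        (.write 20 0 (var 20 + var 21 / (var 23 + 1)))) <|
    .ite (var 22) .skip (.write 24 0 (var 20)) with houter
  set s2 := outer.run (s1.set 20 0 0) with hs2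
  have f2 : ∀ a, a ∉ (20 :: outer.writes) → s2 a = s1 a := fun a ha => by
    simp only [List.mem_cons, not_or] at ha
    rw [hs2, Cmd.run_frame _ ha.2, Store.set_ne _ ha.1]
  obtain ⟨hsum, hlog⟩ : s2 20 0 = ∑ j ∈ Finset.range (n - 1), fixedLog n j ∧
      (0 < n - 1 → s2 24 0 = fixedLog n 0) := by
    rw [hs2, houter]
    refine Cmd.for_inv (by decide) (s1.set 20 0 0) (m := n - 1) (by simp [f1 0, h0])
      (fun i t => t 20 0 = ∑ j ∈ Finset.range i, fixedLog n j ∧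
        (0 < i → t 24 0 = fixedLog n 0)) (by simp) ?_
    intro i _ t ht hti ⟨I1, I2⟩
    have t0 : t 0 0 = n := by
      rw [ht 0 (by norm_num) (by decide), Store.set_ne _ (by norm_num), f1 0 (by norm_num)
        (by norm_num), h0]
    have t18 : t 18 0 = 2 ^ n := by
      rw [ht 18 (by norm_num) (by decide), Store.set_ne _ (by norm_num), hpow]
    set inner : Cmd := .for 23 N <|
      .seq (.write 21 0 (var 21 / (var 22 + 2)))
        (.write 20 0 (var 20 + var 21 / (var 23 + 1))) with hinner
    set t1 := inner.run (t.set 21 0 (2 ^ n)) with ht1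
    have g1 : ∀ a, a ∉ (21 :: inner.writes) → t1 a = t a := fun a ha => by
      simp only [List.mem_cons, not_or] at ha
      rw [ht1, Cmd.run_frame _ ha.2, Store.set_ne _ ha.1]
    have hin : t1 21 0 = 2 ^ n / (i + 2) ^ n ∧
        t1 20 0 = t 20 0 + ∑ k ∈ Finset.range n, 2 ^ n / (i + 2) ^ (k + 1) / (k + 1) := by
      rw [ht1, hinner]
      refine Cmd.for_inv (by decide) (t.set 21 0 (2 ^ n)) (m := n) (by simp [t0])
        (fun m t' => t' 21 0 = 2 ^ n / (i + 2) ^ m ∧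
          t' 20 0 = t 20 0 + ∑ k ∈ Finset.range m, 2 ^ n / (i + 2) ^ (k + 1) / (k + 1))
        (by simp) ?_
      intro m _ t' ht' htm ⟨J1, J2⟩
      have t22 : t' 22 0 = i := by
        rw [ht' 22 (by norm_num) (by decide), Store.set_ne _ (by norm_num), hti]
      simp [Cmd.run, J1, J2, t22, htm, Finset.sum_range_succ, Nat.div_div_eq_div_mul, pow_succ,
        add_assoc]
    have hbody : (Cmd.seq (.write 21 0 (var 18)) <| .seq inner <|
        .ite (var 22) .skip (.write 24 0 (var 20))).run t =
          (Cmd.ite (var 22) .skip (.write 24 0 (var 20))).run t1 := by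
      simp [Cmd.run, t18, ht1]
    have h22 : t1 22 0 = i := by rw [g1 22 (by decide), hti]
    rw [hbody, Finset.sum_range_succ, ← I1]
    by_cases hi : i = 0
    · subst hi
      simp [Cmd.run, h22, hin.2, I1, fixedLog]
    · have h24 : t1 24 0 = t 24 0 := by rw [g1 24 (by decide)]
      simp [Cmd.run, h22, hi, hin.2, fixedLog, h24]
      exact I2 (by omega)
  have hfin : computeRate.run s 25 0 = (4 * s2 18 0 * s2 18 0 * (s2 20 0 * s2 20 0)) /
      (s2 0 0 * (s2 24 0 * s2 24 0) * (3 * s2 18 0 - 4 * s2 1 0)) := by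
    have : computeRate.run s = (Cmd.write 25 0 (4 * var 18 * var 18 * (var 20 * var 20) /
      (N * (var 24 * var 24) * (3 * var 18 - 4 * var 1)))).run s2 := rfl
    rw [this]
    simp [Cmd.run]
  rw [hfin, hsum, hlog (by omega), f2 18 (by decide), f2 0 (by decide), f2 1 (by decide), hpow,
    f1 0 (by norm_num) (by norm_num), f1 1 (by norm_num) (by norm_num), h0]
  rfl

/-! ### The noise -/

/-- The number with binary digits `f 0, …, f (t - 1)`, the most significant digit first. -/
def horner (f : ℕ → ℕ) : ℕ → ℕ
  | 0 => 0
  | t + 1 => horner f t + horner f t + f t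

/-- 1 if the threshold bits that start at position `o` fall below `L`, else 0. -/
def flag (n L : ℕ) (f : ℕ → ℕ) (o : ℕ) : ℕ := 1 - (1 - (L - horner (fun t => f (o + t)) n))

/-- The additional noise that is sampled with the coins `f`. -/
def noiseBits (n L : ℕ) (f : ℕ → ℕ) : Vec n := Sum.elim
  (fun i => ((flag n L f (i * (n + 2)) * f (i * (n + 2) + n) : ℕ) : ZMod 2))
  (fun i => ((flag n L f (i * (n + 2)) * f (i * (n + 2) + n + 1) : ℕ) : ZMod 2))

lemma sampleNoise_run {n : ℕ} (s : Store) (h0 : s 0 0 = n) :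
    vecOf n (sampleNoise.run s 30) = noiseBits n (s 25 0) (s 4) := by
  have key : ∀ i < n, sampleNoise.run s 30 i =
        flag n (s 25 0) (s 4) (i * (n + 2)) * s 4 (i * (n + 2) + n) % 2 ∧
      sampleNoise.run s 30 (n + i) =
        flag n (s 25 0) (s 4) (i * (n + 2)) * s 4 (i * (n + 2) + n + 1) % 2 := by
    refine Cmd.for_inv (by decide) s (m := n) (by simp [h0])
      (fun m t => ∀ i < m, t 30 i =
          flag n (s 25 0) (s 4) (i * (n + 2)) * s 4 (i * (n + 2) + n) % 2 ∧
        t 30 (n + i) = flag n (s 25 0) (s 4) (i * (n + 2)) * s 4 (i * (n + 2) + n + 1) % 2)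
      (by simp) ?_
    intro i hi t ht hti hI
    have t0 : t 0 = s 0 := ht 0 (by norm_num) (by decide)
    have t4 : t 4 = s 4 := ht 4 (by norm_num) (by decide)
    have t25 : t 25 = s 25 := ht 25 (by norm_num) (by decide)
    set inner : Cmd := .for 28 N (.write 27 0 (var 27 + var 27 +
      .read 4 (var 26 * (N + 2) + var 28))) with hinner
    set t1 := inner.run (t.set 27 0 0) with ht1
    have g1 : ∀ a, a ∉ (27 :: inner.writes) → t1 a = t a := fun a ha => by
      simp only [List.mem_cons, not_or] at ha
      rw [ht1, Cmd.run_frame _ ha.2, Store.set_ne _ ha.1]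
    have hin : t1 27 0 = horner (fun t => s 4 (i * (n + 2) + t)) n := by
      rw [ht1, hinner]
      refine Cmd.for_inv (by decide) (t.set 27 0 0) (m := n) (by simp [t0, h0])
        (fun m t' => t' 27 0 = horner (fun t => s 4 (i * (n + 2) + t)) m) (by simp [horner]) ?_
      intro m _ t' ht' htm hJ
      have e : ∀ a, a ≠ 28 → a ≠ 27 → t' a = t a := fun a ha hb => by
        rw [ht' a ha (by simp [Cmd.writes, hb]), Store.set_ne _ hb]
      simp [Cmd.run, hJ, htm, e 26, e 0, e 4, t0, t4, hti, h0, horner]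
    have h26 : t1 26 0 = i := by rw [g1 26 (by decide), hti]
    have h00 : t1 0 0 = n := by rw [g1 0 (by decide), t0, h0]
    have h4 : t1 4 = s 4 := by rw [g1 4 (by decide), t4]
    have h25 : t1 25 = s 25 := by rw [g1 25 (by decide), t25]
    have h30 : t1 30 = t 30 := g1 30 (by decide)
    set last : Cmd := .seq (.write 29 0 (1 - (1 - (var 25 - var 27)))) <|
      .seq (.write 30 (var 26) (var 29 * .read 4 (var 26 * (N + 2) + N) % 2)) <|
      .write 30 (N + var 26) (var 29 * .read 4 (var 26 * (N + 2) + N + 1) % 2) with hlast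
    have hbody : (Cmd.seq (.write 27 0 0) <| .seq inner last).run t = last.run t1 := rfl
    have hlast30 : ∀ x, (last.run t1).set 26 0 (i + 1) 30 x =
        if x = n + i then flag n (s 25 0) (s 4) (i * (n + 2)) * s 4 (i * (n + 2) + n + 1) % 2
        else if x = i then flag n (s 25 0) (s 4) (i * (n + 2)) * s 4 (i * (n + 2) + n) % 2
        else t 30 x := by
      intro x
      simp [hlast, Cmd.run, h26, h00, h4, h25, hin, flag, Store.set_apply, h30]
    rw [hbody]
    simp only [hlast30]
    intro j hj
    rcases Nat.lt_succ_iff_lt_or_eq.1 hj with h | rfl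
    · rw [if_neg (by omega), if_neg (by omega), if_neg (by omega), if_neg (by omega)]
      exact hI j h
    · rw [if_neg (by omega), if_pos rfl, if_pos rfl]
      exact ⟨rfl, rfl⟩
  funext i
  rcases i with i | i
  · simp only [vecOf, finSumFinEquiv_apply_left, Fin.val_castAdd, (key i i.2).1, noiseBits,
      Sum.elim_inl, ZMod.natCast_mod]
  · simp only [vecOf, finSumFinEquiv_apply_right, Fin.val_natAdd, (key i i.2).2, noiseBits,
      Sum.elim_inr, ZMod.natCast_mod]

/-! ### The query and the answer -/

/-- All columns but the last. -/
def initColumns {n : ℕ} (A : Mat n n) : Mat n (n - 1) :=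
  fun i j => A i (j.castLE (Nat.sub_le n 1))

/-- The memory that contains a matrix and nothing else. -/
def matrixStore {n : ℕ} (A : Mat n n) : Store
  | 0 => fun i => if i = 0 then n else 0
  | 2 => loadBits (matBits A)
  | _ => fun _ => 0

/-- A vector that is orthogonal to all columns of `A` but the last. -/
def pivot {n : ℕ} (A : Mat n n) : Vec n := vecOf n (eliminate.run (matrixStore A) 12)

lemma pivot_spec {m : ℕ} (A : Mat (m + 1) (m + 1))
    (hA : LinearIndependent (ZMod 2) fun j : Fin (m + 1) => fun i => A i j) :
    (∀ j : Fin m, sympInner (pivot A) (fun i => A i j.castSucc) = 0) ∧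
      sympInner (pivot A) (fun i => A i (Fin.last m)) = 1 := by
  have hcol : ∀ j : Fin (m + 1), column (m + 1) (matrixStore A) j = fun i => A i j := fun j => by
    rw [← vecOf_column]; rfl
  have h0 : matrixStore A 0 0 = m + 1 := by simp [matrixStore]
  have := eliminate_run (matrixStore A) h0 _ (Eq.refl _) m rfl (by
    have h := hA.notMem_span_image (s := Set.Iio (Fin.last m)) (x := Fin.last m) (by simp)
    have h1 := hcol (Fin.last m)
    rw [Fin.val_last] at h1
    rw [h1]
    intro h2
    refine h (Submodule.span_mono ?_ h2)
    rintro _ ⟨c, hc, rfl⟩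
    refine ⟨⟨c, (Set.mem_Iio.1 hc).trans (Nat.lt_succ_self m)⟩, ?_, ?_⟩
    · exact Fin.lt_def.2 hc
    · exact (hcol ⟨c, (Set.mem_Iio.1 hc).trans (Nat.lt_succ_self m)⟩).symm)
  rw [← pivot] at this
  refine ⟨fun j => ?_, ?_⟩
  · rw [← hcol]
    exact this.1 j j.2
  · rw [← hcol]
    exact this.2

variable {n : ℕ} (P : ℕ) (A : Mat n n) (u : Vec n) (r : Fin (algorithm.coins.eval n) → ZMod 2)

lemma pre_run_frame (s : Store) {a : ℕ} (ha : a < 5) : algorithm.pre.run s a = s a := by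
  refine Cmd.run_frame _ ?_ s
  have : ∀ a < 5, a ∉ algorithm.pre.writes := by decide
  exact this a ha

lemma readMat_atCall : readMat (algorithm.atCall n P A u r) 5 n (n - 1) = initColumns A := by
  funext i j
  set s := algorithm.start n P A u r
  have h5 : algorithm.atCall n P A u r 5 = copyMatrix.run s 5 := by
    change (Cmd.seq eliminate <| .seq computeRate <| .seq sampleNoise prepareVector).run
      (copyMatrix.run s) 5 = _
    exact Cmd.run_frame _ (by decide) _
  have hj := j.2
  set x : Fin (n + n) := finSumFinEquiv i with hx
  have hval : ((finProdFinEquiv (x, j) : Fin ((n + n) * (n - 1))) : ℕ) = j + (n - 1) * x := rfl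
  have hdiv : (j + (n - 1) * x : ℕ) / (n - 1) = x := by
    rw [Nat.add_mul_div_left _ _ (by omega), Nat.div_eq_of_lt hj, zero_add]
  have hmod : (j + (n - 1) * x : ℕ) % (n - 1) = j := by
    rw [Nat.add_mul_mod_self_left, Nat.mod_eq_of_lt hj]
  unfold readMat
  rw [h5, ← hx, copyMatrix, Cmd.fill_run (by norm_num) s (m := (n + n) * (n - 1))
    (by simp [s, OneCallAlgorithm.start])
    (fun t => loadBits (matBits A) (t / (n - 1) * n + t % (n - 1))), if_pos (Fin.is_lt _), hval,
    hdiv, hmod]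
  · have := loadBits_matBits A i (j.castLE (Nat.sub_le n 1))
    rw [Fin.val_castLE] at this
    rw [this]
    simp [initColumns]
  · intro t _ t' ht' htt _
    simp [ht' 0, ht' 2, htt, s, OneCallAlgorithm.start]

lemma readVec_atCall (hn : 2 ≤ n) : readVec (algorithm.atCall n P A u r) 6 n =
    u + noiseBits n (noiseRate n P) (loadBits r) +
      (loadBits r (n * (n + 2)) : ZMod 2) • pivot A := by
  set s := algorithm.start n P A u r with hs
  set s1 := copyMatrix.run s with hs1
  set s2 := eliminate.run s1 with hs2
  set s3 := computeRate.run s2 with hs3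
  set s4 := sampleNoise.run s3 with hs4
  have h : algorithm.atCall n P A u r = prepareVector.run s4 := rfl
  have f1 : ∀ a, a ∉ copyMatrix.writes → s1 a = s a := fun a ha => Cmd.run_frame _ ha _
  have f2 : ∀ a, a ∉ eliminate.writes → s2 a = s1 a := fun a ha => Cmd.run_frame _ ha _
  have f3 : ∀ a, a ∉ computeRate.writes → s3 a = s2 a := fun a ha => Cmd.run_frame _ ha _
  have f4 : ∀ a, a ∉ sampleNoise.writes → s4 a = s3 a := fun a ha => Cmd.run_frame _ ha _
  have e2 : ∀ a < 5, s2 a = s a := fun a ha => by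
    rw [f2 a (by revert a; decide), f1 a (by revert a; decide)]
  have e3 : ∀ a < 5, s3 a = s a := fun a ha => by rw [f3 a (by revert a; decide), e2 a ha]
  have e4 : ∀ a < 5, s4 a = s a := fun a ha => by rw [f4 a (by revert a; decide), e3 a ha]
  have hs0 : s 0 0 = n := rfl
  have h25 : s3 25 0 = noiseRate n P := by
    rw [hs3, computeRate_run hn s2 (by rw [e2 0 (by norm_num), hs0]), e2 1 (by norm_num)]
    rfl
  have h30 : vecOf n (s4 30) = noiseBits n (noiseRate n P) (loadBits r) := by
    rw [hs4, sampleNoise_run s3 (by rw [e3 0 (by norm_num), hs0]), h25, e3 4 (by norm_num)]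
    rfl
  have h12 : vecOf n (s4 12) = pivot A := by
    rw [f4 12 (by decide), f3 12 (by decide), pivot]
    -- `pivot` is defined by a run without coins or noise rate, hence depends on `A` alone. The
    -- elimination touches only arrays 0, 2 and 9 to 17, on which the two memories agree.
    refine congrArg (vecOf n) (Cmd.run_congr eliminate
      (R := fun a => a = 0 ∨ a = 2 ∨ 9 ≤ a ∧ a ≤ 17) (by decide) ?_ 12 (by decide))
    rintro a (rfl | rfl | ⟨h1, h2⟩)
    · exact f1 0 (by decide)
    · exact f1 2 (by decide)
    · rw [f1 a (by interval_cases a <;> decide)]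
      interval_cases a <;> rfl
  have h6 : ∀ i < n + n, prepareVector.run s4 6 i =
      s 3 i + s4 30 i + s 4 (n * (n + 2)) * s4 12 i % 2 := by
    intro i hi
    rw [prepareVector, Cmd.fill_run (by norm_num) s4 (m := n + n) (by simp [e4 0, hs0])
      (fun i => s 3 i + s4 30 i + s 4 (n * (n + 2)) * s4 12 i % 2), if_pos hi]
    intro i _ t ht hti _
    simp [ht 0, ht 3, ht 4, ht 30, ht 12, e4 0, e4 3, e4 4, hs0, hti]
  rw [h, readVec_eq, vecOf_congr h6, ← h30, ← h12]
  have hu : vecOf n (s 3) = u := vecOf_loadBits u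
  have h4 : s 4 = loadBits r := rfl
  rw [← hu, ← h4]
  funext i
  simp only [vecOf, Nat.cast_add, ZMod.natCast_mod, Nat.cast_mul, Pi.add_apply, Pi.smul_apply,
    smul_eq_mul]

lemma output_eq (b : Bool) : algorithm.output n P A u r b =
    (1 - loadBits r (n * (n + 2))) * b.toNat +
      loadBits r (n * (n + 2)) * ((1 - loadBits r (n * (n + 2) + 1)) * (1 - b.toNat)) := by
  have h0 : (algorithm.answered n P A u r b) 0 0 = n := by
    rw [OneCallAlgorithm.answered, Store.set_ne _ (by norm_num), OneCallAlgorithm.atCall,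
      pre_run_frame _ (by norm_num)]
    rfl
  have h4 : (algorithm.answered n P A u r b) 4 = loadBits r := by
    rw [OneCallAlgorithm.answered, Store.set_ne _ (by norm_num), OneCallAlgorithm.atCall,
      pre_run_frame _ (by norm_num)]
    rfl
  have h7 : (algorithm.answered n P A u r b) 7 0 = b.toNat := by
    rw [OneCallAlgorithm.answered, Store.set_same]
  have h : algorithm.post = answer := rfl
  simp only [OneCallAlgorithm.output, h, answer, Cmd.run, eval_add, eval_mul, eval_sub, eval_read,
    eval_var, eval_N, eval_ofNat, h0, h4, h7, Store.set_same]
  have h1 := loadBits_le_one r (n * (n + 2))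
  have h2 := loadBits_le_one r (n * (n + 2) + 1)
  generalize loadBits r (n * (n + 2)) = x at *
  generalize loadBits r (n * (n + 2) + 1) = y at *
  interval_cases x <;> interval_cases y <;> cases b <;> norm_num

end Reduction

/-! ## Depolarizing noise -/

/-- Depolarizing noise on a single pair. -/
noncomputable def pairWeight (p : ℝ) (a b : ZMod 2) : ℝ := if a = 0 ∧ b = 0 then 1 - p else p / 3

lemma depolarizing_eq {n : ℕ} (p : ℝ) (e : Vec n) :
    depolarizing p e = ∏ i, pairWeight p (e (Sum.inl i)) (e (Sum.inr i)) := rfl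

/-- A vector as a sequence of pairs. -/
def pairsEquiv (n : ℕ) : Vec n ≃ (Fin n → ZMod 2 × ZMod 2) :=
  (Equiv.sumArrowEquivProdArrow (Fin n) (Fin n) (ZMod 2)).trans
    (Equiv.arrowProdEquivProdArrow (Fin n) (fun _ => ZMod 2) (fun _ => ZMod 2)).symm

/-- Independence of the qubit pairs: a sum over vectors of a product over pairs factorizes. -/
lemma sum_prod_pairs {n : ℕ} (g : Fin n → ZMod 2 → ZMod 2 → ℝ) :
    ∑ e : Vec n, ∏ i, g i (e (Sum.inl i)) (e (Sum.inr i)) = ∏ i, ∑ a, ∑ b, g i a b := by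
  simp only [← Fintype.sum_prod_type']
  rw [Finset.prod_univ_sum, Fintype.piFinset_univ]
  exact Fintype.sum_equiv (pairsEquiv n) _ _ fun e => rfl

lemma sum_zmod_two (f : ZMod 2 → ℝ) : ∑ a, f a = f 0 + f 1 := Fin.sum_univ_two f

lemma zmod_two_cases (x : ZMod 2) : x = 0 ∨ x = 1 := by
  revert x; decide

lemma Vec.add_self {n : ℕ} (z : Vec n) : z + z = 0 :=
  funext fun _ => CharTwo.add_self_eq_zero _

lemma sum_depolarizing {n : ℕ} (p : ℝ) : ∑ e : Vec n, depolarizing p e = 1 := by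
  simp only [depolarizing_eq, sum_prod_pairs, sum_zmod_two]
  refine Finset.prod_eq_one fun i _ => ?_
  simp [pairWeight]
  ring

lemma depolarizing_nonneg {n : ℕ} {p : ℝ} (h0 : 0 ≤ p) (h1 : p ≤ 1) (e : Vec n) :
    0 ≤ depolarizing p e := by
  refine Finset.prod_nonneg fun i _ => ?_
  split_ifs <;> linarith

/-- Depolarizing with rate `p` scales the deviation of a pair from uniform by `1 - 4p/3`. These
factors multiply, and `(1 - 4p/3)(1 - 4d/3) = 1 - 4q/3` for the combined rate `q`. -/
lemma sum_pairWeight_mul (p d : ℝ) (x y : ZMod 2) :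
    ∑ a, ∑ b, pairWeight p (x + a) (y + b) * pairWeight d a b =
      pairWeight (p + d - 4 * p * d / 3) x y := by
  have h : (1 : ZMod 2) + 1 = 0 := rfl
  simp only [sum_zmod_two]
  rcases zmod_two_cases x with rfl | rfl <;> rcases zmod_two_cases y with rfl | rfl <;>
    simp [pairWeight, h] <;> ring

/-- The sum of independent depolarizing errors is a depolarizing error. -/
lemma sum_depolarizing_mul {n : ℕ} (p d : ℝ) (F : Vec n → ℝ) :
    ∑ e : Vec n, depolarizing p e * ∑ z : Vec n, depolarizing d z * F (e + z) =
      ∑ e : Vec n, depolarizing (p + d - 4 * p * d / 3) e * F e := by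
  have h1 : ∀ z : Vec n, ∑ e : Vec n, depolarizing p e * (depolarizing d z * F (e + z)) =
      ∑ y : Vec n, depolarizing p (y + z) * (depolarizing d z * F y) := fun z =>
    Fintype.sum_equiv (Equiv.addRight z) _ _ fun e => by
      simp [add_assoc, Vec.add_self]
  simp only [Finset.mul_sum]
  rw [Finset.sum_comm]
  simp only [h1]
  rw [Finset.sum_comm]
  refine Finset.sum_congr rfl fun y _ => ?_
  simp only [← mul_assoc, ← Finset.sum_mul]
  congr 1
  simp only [depolarizing_eq, ← Finset.prod_mul_distrib, Pi.add_apply, ← sum_pairWeight_mul]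
  exact sum_prod_pairs fun i a b =>
    pairWeight p (y (Sum.inl i) + a) (y (Sum.inr i) + b) * pairWeight d a b

/-! ## The distribution of the sampled noise -/

namespace Reduction

lemma horner_congr {f g : ℕ → ℕ} {t : ℕ} (h : ∀ i < t, f i = g i) : horner f t = horner g t := by
  induction t with
  | zero => rfl
  | succ t ih => rw [horner, horner, ih fun i hi => h i (by omega), h t (by omega)]

/-- Each number below `2 ^ n` has exactly one string of `n` digits. Splitting off the last digit,
`2x + c < L` means `x < (L + 1) / 2` for `c = 0` and `x < L / 2` for `c = 1`. -/
lemma card_horner_lt (n L : ℕ) :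
    (Finset.univ.filter fun b : Fin n → ZMod 2 => horner (loadBits b) n < L).card =
      min L (2 ^ n) := by
  induction n generalizing L with
  | zero =>
    simp only [horner, pow_zero]
    rcases Nat.eq_zero_or_pos L with rfl | hL
    · simp
    · simp [hL]
      omega
  | succ n ih =>
    have hs : ∀ (b : Fin n → ZMod 2) (c : ZMod 2),
        horner (loadBits (Fin.snoc b c : Fin (n + 1) → ZMod 2)) (n + 1) =
          horner (loadBits b) n + horner (loadBits b) n + c.val := by
      intro b c
      have h1 : horner (loadBits (Fin.snoc b c : Fin (n + 1) → ZMod 2)) n =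
          horner (loadBits b) n := by
        refine horner_congr fun i hi => ?_
        have : (⟨i, by omega⟩ : Fin (n + 1)) = Fin.castSucc ⟨i, hi⟩ := rfl
        simp [loadBits, hi, show i < n + 1 by omega, this, -Fin.castSucc_mk]
      have h2 : loadBits (Fin.snoc b c : Fin (n + 1) → ZMod 2) n = c.val := by
        have : (⟨n, by omega⟩ : Fin (n + 1)) = Fin.last n := rfl
        simp [loadBits, this, -Fin.natCast_eq_last]
      rw [horner, h1, h2]
    have hcard : (Finset.univ.filter fun b : Fin (n + 1) → ZMod 2 =>
        horner (loadBits b) (n + 1) < L).card =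
        ∑ c : ZMod 2, (Finset.univ.filter fun b : Fin n → ZMod 2 =>
          horner (loadBits b) n + horner (loadBits b) n + c.val < L).card := by
      simp only [Finset.card_filter]
      rw [← (Fin.snocEquiv fun _ : Fin (n + 1) => ZMod 2).sum_comp, Fintype.sum_prod_type]
      exact Finset.sum_congr rfl fun c _ => Finset.sum_congr rfl fun b _ => by rw [← hs]; rfl
    have e0 : ∀ x : ℕ, (x + x + (0 : ZMod 2).val < L) = (x < (L + 1) / 2) := fun x => by
      simp only [ZMod.val_zero, eq_iff_iff]; omega
    have e1 : ∀ x : ℕ, (x + x + (1 : ZMod 2).val < L) = (x < L / 2) := fun x => by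
      simp only [ZMod.val_one, eq_iff_iff]; omega
    rw [hcard, show ∀ f : ZMod 2 → ℕ, ∑ c, f c = f 0 + f 1 from Fin.sum_univ_two]
    simp only [e0, e1, ih, pow_succ]
    omega

/-- The noise on a single pair that is sampled with `n + 2` coins. -/
def pairNoise (n L : ℕ) (b : Fin (n + 2) → ZMod 2) : ZMod 2 × ZMod 2 :=
  if horner (loadBits b) n < L then (b (Fin.natAdd n 0), b (Fin.natAdd n 1)) else 0

/-- The total noise rate, as a depolarization probability. -/
noncomputable def depolRate (n L : ℕ) : ℝ := 3 / 4 * (min L (2 ^ n) : ℕ) / 2 ^ n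

/-- With probability `min L (2 ^ n) / 2 ^ n` the pair is uniform on four values, one of which is
zero; otherwise it is zero. This explains the factor 3/4 in `depolRate`, the rate of the added
noise. -/
lemma card_pairNoise (n L : ℕ) (x y : ZMod 2) :
    (∑ b : Fin (n + 2) → ZMod 2, if pairNoise n L b = (x, y) then (1 : ℝ) else 0) =
      2 ^ (n + 2) * pairWeight (depolRate n L) x y := by
  rw [← (Fin.appendEquiv n 2).sum_comp, Fintype.sum_prod_type]
  have hh : ∀ (b : Fin n → ZMod 2) (c : Fin 2 → ZMod 2),
      pairNoise n L (Fin.appendEquiv n 2 (b, c)) =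
        if horner (loadBits b) n < L then (c 0, c 1) else 0 := by
    intro b c
    have h1 : horner (loadBits (Fin.append b c)) n = horner (loadBits b) n := by
      refine horner_congr fun i hi => ?_
      have : (⟨i, by omega⟩ : Fin (n + 2)) = Fin.castAdd 2 ⟨i, hi⟩ := rfl
      simp [loadBits, hi, show i < n + 2 by omega, this, -Fin.castAdd_mk]
    simp only [pairNoise, Fin.appendEquiv, Equiv.coe_fn_mk, h1, Fin.append_right]
  simp only [hh]
  have hin : ∀ b : Fin n → ZMod 2,
      (∑ c : Fin 2 → ZMod 2, if (if horner (loadBits b) n < L then (c 0, c 1) else 0) = (x, y)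
        then (1 : ℝ) else 0) = if horner (loadBits b) n < L then 1 else
          (if x = 0 ∧ y = 0 then 4 else 0) := by
    intro b
    rw [← (finTwoArrowEquiv (ZMod 2)).symm.sum_comp, Fintype.sum_prod_type]
    simp only [sum_zmod_two]
    rcases zmod_two_cases x with rfl | rfl <;> rcases zmod_two_cases y with rfl | rfl <;>
      split_ifs <;> simp_all [finTwoArrowEquiv, Prod.ext_iff] <;> norm_num
  simp only [hin]
  have hle : min L (2 ^ n) ≤ 2 ^ n := min_le_right _ _
  have hcompl : ((Finset.univ.filter fun b : Fin n → ZMod 2 =>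
      ¬ horner (loadBits b) n < L).card : ℝ) = 2 ^ n - (min L (2 ^ n) : ℕ) := by
    have := Finset.card_filter_add_card_filter_not (s := Finset.univ)
      (fun b : Fin n → ZMod 2 => horner (loadBits b) n < L)
    rw [card_horner_lt, Finset.card_univ, Fintype.card_fun, ZMod.card, Fintype.card_fin] at this
    rw [eq_sub_iff_add_eq']
    exact_mod_cast this
  rw [Finset.sum_ite, Finset.sum_const, Finset.sum_const, nsmul_eq_mul, nsmul_eq_mul, hcompl,
    card_horner_lt, pairWeight, depolRate, pow_add]
  have h2 : (2 : ℝ) ^ n ≠ 0 := by positivity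
  split_ifs <;> field_simp <;> ring

/-- The sum over all coins of a function of the sampled noise and of two further coins. -/
lemma sum_coins (n L : ℕ) {K : ℕ} (hK : K = n * (n + 2) + 2)
    (Φ : Vec n → ℕ → ℕ → ℝ) :
    Finset.expect Finset.univ (fun r : Fin K → ZMod 2 => Φ (noiseBits n L (loadBits r))
        (loadBits r (n * (n + 2))) (loadBits r (n * (n + 2) + 1))) =
      ∑ z, depolarizing (depolRate n L) z * ((Φ z 0 0 + Φ z 0 1 + Φ z 1 0 + Φ z 1 1) / 4) := by
  subst hK
  -- The coins split into `n` blocks of `n + 2`, each with `n` threshold digits and the two bits of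
  -- a pair, followed by two control coins.
  set E : ((Fin n → Fin (n + 2) → ZMod 2) × (Fin 2 → ZMod 2)) ≃
      (Fin (n * (n + 2) + 2) → ZMod 2) :=
    (((Equiv.curry (Fin n) (Fin (n + 2)) (ZMod 2)).symm.trans
      (finProdFinEquiv.arrowCongr (Equiv.refl _))).prodCongr (Equiv.refl _)).trans
      (Fin.appendEquiv (n * (n + 2)) 2) with hE
  have hblock : ∀ b c (i : Fin n) (t : ℕ) (ht : t < n + 2),
      loadBits (E (b, c)) (i * (n + 2) + t) = (b i ⟨t, ht⟩).val := by
    intro b c i t ht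
    have hlt : i * (n + 2) + t < n * (n + 2) := by
      have := Nat.mul_le_mul_right (n + 2) (show (i : ℕ) + 1 ≤ n from i.2)
      rw [Nat.add_mul] at this
      omega
    have hidx : (⟨i * (n + 2) + t, by omega⟩ : Fin (n * (n + 2) + 2)) =
        Fin.castAdd 2 (finProdFinEquiv (i, (⟨t, ht⟩ : Fin (n + 2)))) := by
      ext
      simp [finProdFinEquiv]
      ring
    rw [loadBits, dif_pos (by omega), hidx]
    simp [hE, Fin.appendEquiv]
  have hctrl : ∀ b c (j : Fin 2), loadBits (E (b, c)) (n * (n + 2) + j) = (c j).val := by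
    intro b c j
    have hidx : (⟨n * (n + 2) + j, by omega⟩ : Fin (n * (n + 2) + 2)) =
        Fin.natAdd (n * (n + 2)) j := rfl
    rw [loadBits, dif_pos (by omega), hidx]
    simp [hE, Fin.appendEquiv]
  have hnoise : ∀ b c, noiseBits n L (loadBits (E (b, c))) =
      (pairsEquiv n).symm fun i => pairNoise n L (b i) := by
    intro b c
    have hflag : ∀ i : Fin n, flag n L (loadBits (E (b, c))) (i * (n + 2)) =
        if horner (loadBits (b i)) n < L then 1 else 0 := by
      intro i
      have : horner (fun t => loadBits (E (b, c)) (i * (n + 2) + t)) n =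
          horner (loadBits (b i)) n := horner_congr fun t ht => by
        rw [hblock b c i t (by omega), loadBits, dif_pos (by omega)]
      rw [flag, this]
      split_ifs <;> omega
    have hn1 : ∀ i : Fin n, loadBits (E (b, c)) (i * (n + 2) + n + 1) =
        (b i (Fin.natAdd n 1)).val := fun i => hblock b c i (n + 1) (by omega)
    have hn0 : ∀ i : Fin n, loadBits (E (b, c)) (i * (n + 2) + n) =
        (b i (Fin.natAdd n 0)).val := fun i => hblock b c i n (by omega)
    funext i
    rcases i with i | i
    · simp only [noiseBits, Sum.elim_inl, hflag, hn0]
      change _ = (pairNoise n L (b i)).1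
      unfold pairNoise
      split_ifs <;> simp
    · simp only [noiseBits, Sum.elim_inr, hflag, hn1]
      change _ = (pairNoise n L (b i)).2
      unfold pairNoise
      split_ifs <;> simp
  have hlaw : ∀ F : Vec n → ℝ, ∑ b : Fin n → Fin (n + 2) → ZMod 2,
      F ((pairsEquiv n).symm fun i => pairNoise n L (b i)) =
        2 ^ (n * (n + 2)) * ∑ z, depolarizing (depolRate n L) z * F z := by
    intro F
    -- Writing `F` as a sum over `z` of products of indicators, one for each block, lets the sum
    -- over the coins factorize.
    have h1 : ∀ b : Fin n → Fin (n + 2) → ZMod 2,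
        F ((pairsEquiv n).symm fun i => pairNoise n L (b i)) =
          ∑ z : Vec n, (∏ i, if pairNoise n L (b i) = (z (Sum.inl i), z (Sum.inr i))
            then (1 : ℝ) else 0) * F z := by
      intro b
      rw [Finset.sum_eq_single ((pairsEquiv n).symm fun i => pairNoise n L (b i))]
      · rw [Finset.prod_eq_one, one_mul]
        intro i _
        exact if_pos rfl
      · intro z _ hz
        rw [mul_eq_zero]
        left
        by_contra h
        rw [← ne_eq, Finset.prod_ne_zero_iff] at h
        refine hz ?_
        rw [Equiv.eq_symm_apply]
        funext i
        have := h i (Finset.mem_univ i)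
        rw [ne_eq, ite_eq_right_iff, not_forall] at this
        exact this.1.symm
      · simp
    simp only [h1]
    rw [Finset.sum_comm, Finset.mul_sum]
    refine Finset.sum_congr rfl fun z _ => ?_
    rw [← Finset.sum_mul, ← mul_assoc]
    congr 1
    have h2 := Finset.prod_univ_sum (fun _ : Fin n => (Finset.univ : Finset (Fin (n + 2) → ZMod 2)))
      (fun i b => if pairNoise n L b = (z (Sum.inl i), z (Sum.inr i)) then (1 : ℝ) else 0)
    rw [Fintype.piFinset_univ] at h2
    rw [← h2, depolarizing_eq]
    simp only [card_pairNoise, Finset.prod_mul_distrib, Finset.prod_const, Finset.card_univ,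
      Fintype.card_fin, ← pow_mul, mul_comm]
  rw [Fintype.expect_eq_sum_div_card, ← E.sum_comp, Fintype.sum_prod_type, Finset.sum_comm,
    ← (finTwoArrowEquiv (ZMod 2)).symm.sum_comp, Fintype.sum_prod_type]
  have hc0 : ∀ b c, loadBits (E (b, c)) (n * (n + 2)) = (c 0).val := fun b c => hctrl b c 0
  have hc1 : ∀ b c, loadBits (E (b, c)) (n * (n + 2) + 1) = (c 1).val := fun b c => hctrl b c 1
  simp only [hnoise, hc0, hc1, sum_zmod_two]
  have hlaw' := fun i j => hlaw fun z => Φ z i j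
  simp only [hlaw']
  have hcard : (Fintype.card (Fin (n * (n + 2) + 2) → ZMod 2) : ℝ) = 2 ^ (n * (n + 2)) * 4 := by
    rw [Fintype.card_fun, ZMod.card, Fintype.card_fin]
    push_cast
    rw [pow_add]
    norm_num
  rw [hcard, ← mul_add, ← mul_add, ← mul_add, mul_div_mul_left _ _ (by positivity),
    ← Finset.sum_add_distrib, ← Finset.sum_add_distrib, ← Finset.sum_add_distrib, Finset.sum_div]
  refine Finset.sum_congr rfl fun z _ => ?_
  have h2 : ∀ a b, (finTwoArrowEquiv (ZMod 2)).symm (a, b) = ![a, b] := fun _ _ => rfl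
  simp only [h2, Matrix.cons_val_zero, Matrix.cons_val_one, ZMod.val_zero, ZMod.val_one]
  ring

end Reduction

/-! ## Extensions of isotropic matrices by one column -/

/-- The span of the columns. -/
abbrev colSpan {n m : ℕ} (B : Mat n m) : Submodule (ZMod 2) (Vec n) :=
  Submodule.span (ZMod 2) (Set.range B.col)

lemma mem_codes {n k : ℕ} {A : Mat n k} :
    A ∈ codes n k ↔ IsIsotropic A ∧ LinearIndependent (ZMod 2) A.col := by
  classical
  rw [codes, Finset.mem_filter, linearIndependent_iff_card_eq_finrank_span, Set.finrank,
    ← Matrix.rank_eq_finrank_span_cols, Fintype.card_fin]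
  simp [eq_comm]

/-- The vectors that are orthogonal to all columns, but not in their span. -/
noncomputable def extensions {n m : ℕ} (B : Mat n m) : Finset (Vec n) :=
  letI := Classical.decPred fun c : Vec n => (∀ j, sympInner c (B.col j) = 0) ∧ c ∉ colSpan B
  Finset.univ.filter fun c => (∀ j, sympInner c (B.col j) = 0) ∧ c ∉ colSpan B

lemma mem_extensions {n m : ℕ} {B : Mat n m} {c : Vec n} :
    c ∈ extensions B ↔ (∀ j, sympInner c (B.col j) = 0) ∧ c ∉ colSpan B := by
  simp [extensions]

/-- All columns but the last. -/
def dropLast {n m : ℕ} (A : Mat n (m + 1)) : Mat n m := fun i j => A i j.castSucc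

/-- The matrix with one more column. -/
def addColumn {n m : ℕ} (B : Mat n m) (c : Vec n) : Mat n (m + 1) := fun i => Fin.snoc (B i) (c i)

@[simp] lemma dropLast_addColumn {n m : ℕ} (B : Mat n m) (c : Vec n) :
    dropLast (addColumn B c) = B := by
  funext i j; simp [dropLast, addColumn]

@[simp] lemma col_addColumn_last {n m : ℕ} (B : Mat n m) (c : Vec n) :
    (addColumn B c).col (Fin.last m) = c := by
  funext i; simp [addColumn, Matrix.col]

@[simp] lemma addColumn_dropLast {n m : ℕ} (A : Mat n (m + 1)) :
    addColumn (dropLast A) (A.col (Fin.last m)) = A := by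
  funext i j
  refine Fin.lastCases ?_ (fun j => ?_) j
  · simp [addColumn, Matrix.col]
  · simp [addColumn, dropLast]

lemma addColumn_mem_codes {n m : ℕ} {B : Mat n m} {c : Vec n} :
    addColumn B c ∈ codes n (m + 1) ↔ B ∈ codes n m ∧ c ∈ extensions B := by
  have hcol : (addColumn B c).col = Fin.snoc B.col c := by
    funext j
    refine Fin.lastCases ?_ (fun j => ?_) j
    · simp
    · funext i
      rw [Fin.snoc_castSucc]
      simp [addColumn, Matrix.col]
  have hiso : IsIsotropic (addColumn B c) ↔
      IsIsotropic B ∧ ∀ j, sympInner c (B.col j) = 0 := by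
    have : IsIsotropic (addColumn B c) ↔
        ∀ i j, sympInner ((addColumn B c).col i) ((addColumn B c).col j) = 0 := Iff.rfl
    rw [this, hcol]
    simp only [Fin.forall_fin_succ', Fin.snoc_castSucc, Fin.snoc_last, sympInner_self, and_true,
      sympInner_comm (B.col _) c]
    constructor
    · exact fun h => ⟨fun i j => (h.1 i).1 j, h.2⟩
    · exact fun h => ⟨fun i => ⟨fun j => h.1 i j, h.2 i⟩, h.2⟩
  rw [mem_codes, mem_codes, mem_extensions, hiso, hcol, linearIndependent_finSnoc]
  tauto

/-- A sum over codes, by their columns but the last. -/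
lemma sum_codes_succ {n m : ℕ} (h : Mat n m → Vec n → ℝ) :
    ∑ A ∈ codes n (m + 1), h (dropLast A) (A.col (Fin.last m)) =
      ∑ B ∈ codes n m, ∑ c ∈ extensions B, h B c := by
  rw [Finset.sum_sigma']
  refine Finset.sum_bij' (fun A _ => ⟨dropLast A, A.col (Fin.last m)⟩)
    (fun x _ => addColumn x.1 x.2) ?_ ?_ ?_ ?_ ?_
  · intro A hA
    rw [← addColumn_dropLast A, addColumn_mem_codes] at hA
    simpa using hA
  · rintro ⟨B, c⟩ hx
    rw [Finset.mem_sigma] at hx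
    exact addColumn_mem_codes.2 hx
  · intro A _
    simp
  · rintro ⟨B, c⟩ _
    simp
  · intro A _
    rfl

/-- The complement of the `m` independent columns has dimension `2 (m + 1) - m = m + 2` and contains
their span, so the count is `2 ^ (m + 2) - 2 ^ m`. That it is the same for every `B` makes the
truncation of a uniform code uniform. -/
lemma card_extensions {m : ℕ} {B : Mat (m + 1) m} (hB : B ∈ codes (m + 1) m) :
    (extensions B).card = 3 * 2 ^ m := by
  classical
  rw [mem_codes] at hB
  -- Exchanging the two halves of the rows turns the dot product into the symplectic one.
  set φ : Vec (m + 1) →ₗ[ZMod 2] (Fin m → ZMod 2) :=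
    ((B.submatrix (Equiv.sumComm _ _) (Equiv.refl _)).transpose).mulVecLin with hφ
  have hφapply : ∀ c j, φ c j = sympInner c (B.col j) := by
    intro c j
    simp [hφ, Matrix.mulVec, dotProduct, sympInner, Matrix.col, ← Finset.sum_add_distrib]
    exact Finset.sum_congr rfl fun i _ => by ring
  have hker : ∀ c, c ∈ LinearMap.ker φ ↔ ∀ j, sympInner c (B.col j) = 0 := fun c => by
    simp only [LinearMap.mem_ker, funext_iff, hφapply, Pi.zero_apply]
  have hrankB : Module.finrank (ZMod 2) (colSpan B) = m := by
    rw [finrank_span_eq_card hB.2, Fintype.card_fin]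
  have hrank : Module.finrank (ZMod 2) (LinearMap.range φ) = m := by
    have : Module.finrank (ZMod 2) (LinearMap.range φ) =
      ((B.submatrix (Equiv.sumComm _ _) (Equiv.refl _)).transpose).rank := rfl
    rw [this, Matrix.rank_transpose, Matrix.rank_submatrix, Matrix.rank_eq_finrank_span_cols,
      hrankB]
  have hkerdim : Module.finrank (ZMod 2) (LinearMap.ker φ) = m + 2 := by
    have := LinearMap.finrank_range_add_finrank_ker φ
    rw [hrank, Module.finrank_fintype_fun_eq_card, Fintype.card_sum, Fintype.card_fin] at this
    omega
  have hle : colSpan B ≤ LinearMap.ker φ := by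
    rw [Submodule.span_le]
    rintro _ ⟨i, rfl⟩
    exact (hker _).2 fun j => hB.1 i j
  have hext : extensions B = (Finset.univ.filter fun c => c ∈ LinearMap.ker φ) \
      (Finset.univ.filter fun c => c ∈ colSpan B) := by
    ext c
    simp [mem_extensions, ← hker]
  have hcard : ∀ S : Submodule (ZMod 2) (Vec (m + 1)),
      (Finset.univ.filter fun c => c ∈ S).card = 2 ^ Module.finrank (ZMod 2) S := by
    intro S
    rw [← Fintype.card_subtype, Module.card_eq_pow_finrank (K := ZMod 2) (V := S), ZMod.card]
  rw [hext, Finset.card_sdiff_of_subset, hcard, hcard, hkerdim, hrankB, pow_add]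
  · omega
  · intro c
    simp only [Finset.mem_filter, Finset.mem_univ, true_and]
    exact fun h => hle h

/-- The columns but the last of a random code form a random code. -/
lemma sum_codes_dropLast {m : ℕ} (g : Mat (m + 1) m → ℝ) :
    ∑ A ∈ codes (m + 1) (m + 1), g (dropLast A) = 3 * 2 ^ m * ∑ B ∈ codes (m + 1) m, g B := by
  rw [sum_codes_succ fun B _ => g B, Finset.mul_sum]
  refine Finset.sum_congr rfl fun B hB => ?_
  rw [Finset.sum_const, card_extensions hB, nsmul_eq_mul]
  push_cast
  ring

lemma expect_codes_dropLast {m : ℕ} (g : Mat (m + 1) m → ℝ) :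
    Finset.expect (codes (m + 1) (m + 1)) (fun A => g (dropLast A)) =
      Finset.expect (codes (m + 1) m) g := by
  have hcard := sum_codes_dropLast (m := m) fun _ => 1
  simp only [Finset.sum_const, nsmul_eq_mul, mul_one] at hcard
  rw [Finset.expect_eq_sum_div_card, Finset.expect_eq_sum_div_card, sum_codes_dropLast, hcard,
    mul_div_mul_left _ _ (by positivity)]

lemma sympInner_mulVec {n m : ℕ} (B : Mat n m) (c : Vec n) (x : Fin m → ZMod 2)
    (h : ∀ j, sympInner c (B.col j) = 0) : sympInner c (B.mulVec x) = 0 := by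
  rw [Matrix.mulVec_eq_sum]
  induction (Finset.univ : Finset (Fin m)) using Finset.induction_on with
  | empty => simp
  | insert a s ha ih =>
    rw [Finset.sum_insert ha, sympInner_add_right, ih, add_zero]
    have : MulOpposite.op (x a) • B.transpose a = x a • B.col a := by
      funext i; simp [Matrix.col, mul_comm]
    rw [this, sympInner_smul_right, h, mul_zero]

lemma mulVec_mem_colSpan {n m : ℕ} (B : Mat n m) (c : Vec n) :
    c ∈ colSpan B ↔ ∃ x, B.mulVec x = c := by
  rw [colSpan, ← Matrix.range_mulVecLin]
  simp

/-- The extensions of a code form three cosets. -/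
lemma sum_extensions {m : ℕ} {B : Mat (m + 1) m} (hB : B ∈ codes (m + 1) m) {a a' : Vec (m + 1)}
    (ha : ∀ j, sympInner a (B.col j) = 0) (ha' : ∀ j, sympInner a' (B.col j) = 0)
    (haa' : sympInner a' a = 1) {f : Vec (m + 1) → ℝ} (hf : ∀ x c, f (B.mulVec x + c) = f c) :
    ∑ c ∈ extensions B, f c = 2 ^ m * (f a + f a' + f (a + a')) := by
  classical
  set T : Finset (ZMod 2 × ZMod 2) := {(1, 0), (0, 1), (1, 1)} with hT
  set F : (Fin m → ZMod 2) × (ZMod 2 × ZMod 2) → Vec (m + 1) :=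
    fun y => B.mulVec y.1 + (y.2.1 • a + y.2.2 • a') with hF
  have haa : sympInner a a' = 1 := by rw [sympInner_comm, haa']
  -- Pairing with `a` returns the coefficient of `a'`, and pairing with `a'` that of `a`. This
  -- yields injectivity of `F` and keeps its values on `T` out of the span of `B`; counting then
  -- gives all extensions.
  have hFa : ∀ y, sympInner a (F y) = y.2.2 := fun y => by
    simp [hF, sympInner_add_right, sympInner_smul_right, sympInner_mulVec B a _ ha, sympInner_self,
      haa]
  have hFa' : ∀ y, sympInner a' (F y) = y.2.1 := fun y => by
    simp [hF, sympInner_add_right, sympInner_smul_right, sympInner_mulVec B a' _ ha',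
      sympInner_self, haa']
  have hinjB : Function.Injective B.mulVec := Matrix.mulVec_injective_iff.2 (mem_codes.1 hB).2
  have hinj : Function.Injective F := by
    intro y z hyz
    have h1 : y.2.2 = z.2.2 := by rw [← hFa, ← hFa, hyz]
    have h2 : y.2.1 = z.2.1 := by rw [← hFa', ← hFa', hyz]
    have h3 : B.mulVec y.1 = B.mulVec z.1 := by
      simp only [hF, h1, h2, add_left_inj] at hyz
      exact hyz
    exact Prod.ext (hinjB h3) (Prod.ext h2 h1)
  have himage : (Finset.univ ×ˢ T).image F = extensions B := by
    refine Finset.eq_of_subset_of_card_le ?_ ?_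
    · intro c hc
      obtain ⟨y, hy, rfl⟩ := Finset.mem_image.1 hc
      rw [mem_extensions]
      refine ⟨fun j => ?_, fun hmem => ?_⟩
      · have : sympInner (B.mulVec y.1) (B.col j) = 0 := by
          rw [sympInner_comm]
          exact sympInner_mulVec B _ _ fun j' => (mem_codes.1 hB).1 j j'
        simp [hF, sympInner_add_left, sympInner_smul_left, ha, ha', this]
      · obtain ⟨x, hx⟩ := (mulVec_mem_colSpan B _).1 hmem
        have h1 := hFa y
        have h2 := hFa' y
        rw [← hx, sympInner_mulVec B _ _ ha] at h1
        rw [← hx, sympInner_mulVec B _ _ ha'] at h2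
        have : y.2 = (0, 0) := Prod.ext h2.symm h1.symm
        have hy2 := (Finset.mem_product.1 hy).2
        rw [this] at hy2
        revert hy2
        decide
    · rw [card_extensions hB, Finset.card_image_of_injective _ hinj, Finset.card_product,
        Finset.card_univ, Fintype.card_fun, ZMod.card, Fintype.card_fin,
        show T.card = 3 from rfl, mul_comm]
  rw [← himage, Finset.sum_image fun y _ z _ h => hinj h, Finset.sum_product]
  simp only [hF, hf]
  rw [Finset.sum_const, Finset.card_univ, Fintype.card_fun, ZMod.card, Fintype.card_fin,
    nsmul_eq_mul, hT, Finset.sum_insert (by decide), Finset.sum_insert (by decide),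
    Finset.sum_singleton]
  simp [add_assoc]

/-- Replacing the last column of a random code by another nontrivial coset does not change
averages. -/
lemma expect_codes_shift {m : ℕ} {h : Mat (m + 1) m → Vec (m + 1) → ℝ}
    (hh : ∀ B x c, h B (B.mulVec x + c) = h B c) {a' : Mat (m + 1) (m + 1) → Vec (m + 1)}
    (ha' : ∀ A ∈ codes (m + 1) (m + 1),
      (∀ j, sympInner (a' A) ((dropLast A).col j) = 0) ∧
        sympInner (a' A) (A.col (Fin.last m)) = 1) :
    Finset.expect (codes (m + 1) (m + 1)) (fun A => (h (dropLast A) (a' A) +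
        h (dropLast A) (A.col (Fin.last m) + a' A)) / 2) =
      Finset.expect (codes (m + 1) (m + 1)) fun A => h (dropLast A) (A.col (Fin.last m)) := by
  rw [Finset.expect_eq_sum_div_card, Finset.expect_eq_sum_div_card]
  congr 1
  -- The vector `a' A` may depend on all of `A`, so no bijection of codes is at hand. Instead the
  -- two cosets are written as all three minus that of the last column. Averaged over `A`, the three
  -- together contribute three times the right-hand side, and `(3 - 1) / 2 = 1`.
  have key : ∀ A ∈ codes (m + 1) (m + 1), (h (dropLast A) (a' A) +
      h (dropLast A) (A.col (Fin.last m) + a' A)) / 2 =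
        ((∑ c ∈ extensions (dropLast A), h (dropLast A) c) / 2 ^ m -
          h (dropLast A) (A.col (Fin.last m))) / 2 := by
    intro A hA
    have hmem := hA
    rw [← addColumn_dropLast A, addColumn_mem_codes] at hmem
    rw [sum_extensions hmem.1 (mem_extensions.1 hmem.2).1 (ha' A hA).1 (ha' A hA).2
      (hh (dropLast A)), mul_div_cancel_left₀ _ (by positivity)]
    ring
  rw [Finset.sum_congr rfl key, ← Finset.sum_div, Finset.sum_sub_distrib,
    sum_codes_dropLast fun B => (∑ c ∈ extensions B, h B c) / 2 ^ m, sum_codes_succ,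
    ← Finset.sum_div]
  have : (2 : ℝ) ^ m ≠ 0 := by positivity
  field_simp
  ring

namespace Reduction

/-! ## The advantage of the reduction -/

lemma coins_eval (n : ℕ) : algorithm.coins.eval n = n * (n + 2) + 2 := by
  simp [algorithm]

/-- The average of the oracle's answers under additional noise. -/
noncomputable def noisy {n m : ℕ} (d : ℝ) (O : Mat n m → Vec n → ℝ) (B : Mat n m) (v : Vec n) : ℝ :=
  ∑ z : Vec n, depolarizing d z * O B (v + z)

/-- Of the four outcomes of the control coins, two return the answer on `u`, one negates the answer
on `u + pivot A`, and one returns 0. -/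
lemma acceptProb_eq {m : ℕ} (hm : 1 ≤ m) (P : ℕ) (O : Mat (m + 1) m → Vec (m + 1) → ℝ)
    (A : Mat (m + 1) (m + 1)) (u : Vec (m + 1)) :
    algorithm.acceptProb (m + 1) P O A u =
      noisy (depolRate (m + 1) (noiseRate (m + 1) P)) O (dropLast A) u / 2 +
        (1 - noisy (depolRate (m + 1) (noiseRate (m + 1) P)) O (dropLast A) (u + pivot A)) / 4 := by
  set L := noiseRate (m + 1) P with hL
  have h := sum_coins (m + 1) L (coins_eval (m + 1)) fun z c d =>
    O (dropLast A) (u + z + (c : ZMod 2) • pivot A) * ((1 - c) * 1 + c * ((1 - d) * (1 - 1))) +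
      (1 - O (dropLast A) (u + z + (c : ZMod 2) • pivot A)) *
        ((1 - c) * 0 + c * ((1 - d) * (1 - 0)))
  have hacc : algorithm.acceptProb (m + 1) P O A u =
      ∑ z : Vec (m + 1), depolarizing (depolRate (m + 1) L) z * ((O (dropLast A) (u + z) * 2 +
        (1 - O (dropLast A) (u + pivot A + z))) / 4) := by
    rw [OneCallAlgorithm.acceptProb]
    simp only [readVec_atCall P A u _ (show 2 ≤ m + 1 by omega), readMat_atCall, output_eq,
      Bool.toNat_true, Bool.toNat_false, Nat.cast_one, Nat.cast_zero, ← hL]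
    refine Eq.trans ?_ (h.trans ?_)
    · rfl
    · refine Finset.sum_congr rfl fun z _ => ?_
      have : u + z + pivot A = u + pivot A + z := by abel
      simp [this]
      left
      ring
  rw [hacc, noisy, noisy]
  have hone : (1 : ℝ) = ∑ z : Vec (m + 1), depolarizing (depolRate (m + 1) L) z :=
    (sum_depolarizing _).symm
  conv_rhs => rw [hone, ← Finset.sum_sub_distrib, Finset.sum_div, Finset.sum_div,
    ← Finset.sum_add_distrib]
  exact Finset.sum_congr rfl fun z _ => by ring

/-- The average of the oracle's answers on noisy codewords that are shifted by `v`. -/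
noncomputable def cosetAverage {n m : ℕ} (q : ℝ) (O : Mat n m → Vec n → ℝ) (B : Mat n m)
    (v : Vec n) : ℝ :=
  Finset.expect Finset.univ fun x : Fin m → ZMod 2 =>
    ∑ e : Vec n, depolarizing q e * O B (B.mulVec x + v + e)

/-- The uniform codeword absorbs the shift, so `cosetAverage q O B` is a function of cosets, as
`expect_codes_shift` demands. -/
lemma cosetAverage_mulVec_add {n m : ℕ} (q : ℝ) (O : Mat n m → Vec n → ℝ) (B : Mat n m)
    (x : Fin m → ZMod 2) (v : Vec n) :
    cosetAverage q O B (B.mulVec x + v) = cosetAverage q O B v := by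
  refine Fintype.expect_equiv (Equiv.addRight x) _ _ fun y => ?_
  simp [Matrix.mulVec_add, add_assoc]

lemma expect_mulVec_succ {n m : ℕ} (A : Mat n (m + 1)) (g : Vec n → ℝ) :
    Finset.expect Finset.univ (fun x : Fin (m + 1) → ZMod 2 => g (A.mulVec x)) =
      (Finset.expect Finset.univ (fun x : Fin m → ZMod 2 => g ((dropLast A).mulVec x)) +
        Finset.expect Finset.univ (fun x : Fin m → ZMod 2 =>
          g ((dropLast A).mulVec x + A.col (Fin.last m)))) / 2 := by
  have hs : ∀ (x : Fin m → ZMod 2) (c : ZMod 2), A.mulVec (Fin.snoc x c : Fin (m + 1) → ZMod 2) =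
      (dropLast A).mulVec x + c • A.col (Fin.last m) := by
    intro x c
    funext i
    simp [Matrix.mulVec, dotProduct, Fin.sum_univ_castSucc, dropLast, Matrix.col, mul_comm]
  have hsum : ∑ x : Fin (m + 1) → ZMod 2, g (A.mulVec x) =
      ∑ c : ZMod 2, ∑ x : Fin m → ZMod 2, g ((dropLast A).mulVec x + c • A.col (Fin.last m)) := by
    rw [← (Fin.snocEquiv fun _ : Fin (m + 1) => ZMod 2).sum_comp, Fintype.sum_prod_type]
    exact Finset.sum_congr rfl fun c _ => Finset.sum_congr rfl fun x _ => by rw [← hs]; rfl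
  simp only [Fintype.expect_eq_sum_div_card, Fintype.card_fun, ZMod.card, Fintype.card_fin]
  rw [hsum, sum_zmod_two]
  simp only [zero_smul, add_zero, one_smul]
  push_cast
  rw [pow_succ]
  field_simp

/-- Replacing noise of rate `p` by the reduction's combined noise. -/
lemma sum_depolarizing_noisy {n m : ℕ} (p d : ℝ) (O : Mat n m → Vec n → ℝ) (B : Mat n m)
    (v w : Vec n) :
    ∑ e : Vec n, depolarizing p e * noisy d O B (v + e + w) =
      ∑ e : Vec n, depolarizing (p + d - 4 * p * d / 3) e * O B (v + w + e) := by
  rw [← sum_depolarizing_mul p d fun e => O B (v + w + e)]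
  refine Finset.sum_congr rfl fun e _ => ?_
  congr 1
  refine Finset.sum_congr rfl fun z _ => ?_
  rw [show v + e + w + z = v + w + (e + z) by abel]

/-- A uniform vector absorbs both the shift and the noise. -/
lemma expect_noisy {n m : ℕ} (d : ℝ) (O : Mat n m → Vec n → ℝ) (B : Mat n m) (w : Vec n) :
    Finset.expect Finset.univ (fun u : Vec n => noisy d O B (u + w)) =
      Finset.expect Finset.univ fun u : Vec n => O B u := by
  rw [Fintype.expect_eq_sum_div_card, Fintype.expect_eq_sum_div_card]
  congr 1
  simp only [noisy]
  rw [Finset.sum_comm]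
  have : ∀ z : Vec n, ∑ u : Vec n, depolarizing d z * O B (u + w + z) =
      depolarizing d z * ∑ u : Vec n, O B u := fun z => by
    rw [← Finset.mul_sum, ← Equiv.sum_comp (Equiv.addRight (w + z)) (O B)]
    simp only [Equiv.coe_addRight, add_assoc]
  simp only [this]
  rw [← Finset.sum_mul, sum_depolarizing, one_mul]

/-- The identity is exact: after averaging over codes, the contribution of the shifted coset `a`
cancels between the direct and the negated queries, and the remaining constant 1/4 is common to both
kinds of instances. -/
lemma advantage_algorithm {m : ℕ} (hm : 1 ≤ m) (P : ℕ) (p : ℝ)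
    (O : Mat (m + 1) m → Vec (m + 1) → ℝ) {d : ℝ}
    (hd : d = depolRate (m + 1) (noiseRate (m + 1) P)) :
    advantage (m + 1) (m + 1) p (algorithm.acceptProb (m + 1) P O) =
      advantage m (m + 1) (p + d - 4 * p * d / 3) O / 4 := by
  set q := p + d - 4 * p * d / 3 with hq
  have hacc : ∀ A u, algorithm.acceptProb (m + 1) P O A u =
      noisy d O (dropLast A) u / 2 + (1 - noisy d O (dropLast A) (u + pivot A)) / 4 := by
    intro A u
    rw [acceptProb_eq hm, hd]
  have hin : ∀ A : Mat (m + 1) (m + 1), Finset.expect Finset.univ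
      (fun x : Fin (m + 1) → ZMod 2 => ∑ e : Vec (m + 1), depolarizing p e *
        algorithm.acceptProb (m + 1) P O A (A.mulVec x + e)) =
      (cosetAverage q O (dropLast A) 0 + cosetAverage q O (dropLast A) (A.col (Fin.last m))) / 4 +
        (1 - (cosetAverage q O (dropLast A) (pivot A) +
          cosetAverage q O (dropLast A) (A.col (Fin.last m) + pivot A)) / 2) / 4 := by
    intro A
    have h1 : ∀ v : Vec (m + 1), ∑ e : Vec (m + 1), depolarizing p e *
        algorithm.acceptProb (m + 1) P O A (v + e) =
        (∑ e : Vec (m + 1), depolarizing q e * O (dropLast A) (v + 0 + e)) / 2 +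
          (1 - ∑ e : Vec (m + 1), depolarizing q e * O (dropLast A) (v + pivot A + e)) / 4 := by
      intro v
      rw [hq, ← sum_depolarizing_noisy, ← sum_depolarizing_noisy, ← sum_depolarizing (n := m + 1) p,
        ← Finset.sum_sub_distrib, Finset.sum_div, Finset.sum_div, ← Finset.sum_add_distrib]
      refine Finset.sum_congr rfl fun e _ => ?_
      rw [hacc, add_zero]
      ring
    simp only [h1]
    rw [expect_mulVec_succ A fun v =>
      (∑ e : Vec (m + 1), depolarizing q e * O (dropLast A) (v + 0 + e)) / 2 +
          (1 - ∑ e : Vec (m + 1), depolarizing q e * O (dropLast A) (v + pivot A + e)) / 4]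
    simp only [Finset.expect_add_distrib, ← Finset.expect_div, Finset.expect_sub_distrib,
      Finset.expect_const Finset.univ_nonempty, add_assoc (Matrix.mulVec _ _)]
    simp only [cosetAverage, add_assoc, zero_add, add_zero]
    ring
  have hun : ∀ A : Mat (m + 1) (m + 1), Finset.expect Finset.univ
      (fun u : Vec (m + 1) => algorithm.acceptProb (m + 1) P O A u) =
      Finset.expect Finset.univ (fun u : Vec (m + 1) => O (dropLast A) u) / 4 + 1 / 4 := by
    intro A
    have h0 := expect_noisy d O (dropLast A) 0
    simp only [add_zero] at h0
    simp only [hacc, Finset.expect_add_distrib, ← Finset.expect_div, Finset.expect_sub_distrib,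
      Finset.expect_const Finset.univ_nonempty, expect_noisy, h0]
    ring
  have hshift := expect_codes_shift (h := cosetAverage q O)
    (fun B x c => cosetAverage_mulVec_add q O B x c) (a' := pivot)
    (fun A hA => pivot_spec A (mem_codes.1 hA).2)
  have hS : structuredProb m (m + 1) q O =
      Finset.expect (codes (m + 1) (m + 1)) fun A => cosetAverage q O (dropLast A) 0 := by
    rw [expect_codes_dropLast fun B => cosetAverage q O B 0]
    simp only [cosetAverage, add_zero]
    rfl
  have hU : unstructuredProb m (m + 1) O =
      Finset.expect (codes (m + 1) (m + 1)) fun A =>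
        Finset.expect Finset.univ fun u : Vec (m + 1) => O (dropLast A) u := by
    rw [expect_codes_dropLast fun B => Finset.expect Finset.univ fun u : Vec (m + 1) => O B u]
    rfl
  have hfour : |(4 : ℝ)| = 4 := abs_of_pos (by norm_num)
  rw [advantage, advantage, ← hfour, ← abs_div, structuredProb, unstructuredProb]
  congr 1
  simp only [hin, hun]
  rw [hS, hU]
  simp only [Finset.expect_add_distrib, Finset.expect_sub_distrib, ← Finset.expect_div,
    sub_div, add_div] at hshift ⊢
  linear_combination (-1 / 4) * hshift

/-! ## Accuracy of the noise rate -/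

lemma abs_natDiv_sub_le (a b : ℕ) (hb : 0 < b) : |((a / b : ℕ) : ℝ) - (a : ℝ) / b| ≤ 1 := by
  have h1 := Nat.cast_div_le (α := ℝ) (m := a) (n := b)
  have h2 : (a : ℝ) / b < (a / b : ℕ) + 1 := by
    rw [div_lt_iff₀ (by exact_mod_cast hb)]
    have := Nat.lt_div_mul_add hb (a := a)
    have h3 : a < (a / b + 1) * b := by rw [Nat.add_mul]; omega
    exact_mod_cast h3
  rw [abs_le]
  constructor <;> linarith

/-- `fixedLog n j` approximates the increment from `log (j + 1)` to `log (j + 2)`, through the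
series of `-log (1 - x)` at `x = 1 / (j + 2)`. The `n` terms lose at most 1 each by rounding, as
nested divisions amount to a single one. The tail is at most `1 / 2 ^ n` because `x ≤ 1/2`. -/
lemma abs_fixedLog_sub_le (n j : ℕ) :
    |(fixedLog n j : ℝ) / 2 ^ n - (Real.log (j + 2) - Real.log (j + 1))| ≤ (n + 1) / 2 ^ n := by
  have hj : (0 : ℝ) < j + 2 := by positivity
  set x : ℝ := 1 / (j + 2) with hx
  have hx0 : 0 < x := by positivity
  have hx2 : x ≤ 1 / 2 :=
    one_div_le_one_div_of_le (by norm_num) (by linarith [j.cast_nonneg (α := ℝ)])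
  have hlog : Real.log (j + 2) - Real.log (j + 1) = -Real.log (1 - x) := by
    have : 1 - x = (j + 1) / (j + 2) := by
      rw [hx]
      field_simp
      ring
    rw [← Real.log_div hj.ne' (by positivity), ← Real.log_inv, this, inv_div]
  have htail : |∑ i ∈ Finset.range n, x ^ (i + 1) / (i + 1) + Real.log (1 - x)| ≤ 1 / 2 ^ n := by
    have hxabs : |x| = x := abs_of_pos hx0
    refine (Real.abs_log_sub_add_sum_range_le (by rw [hxabs]; linarith) n).trans ?_
    rw [hxabs, div_le_div_iff₀ (by linarith) (by positivity)]
    have : (x * 2) ^ n ≤ 1 := pow_le_one₀ (by positivity) (by linarith)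
    rw [mul_pow] at this
    rw [pow_succ]
    nlinarith
  have hfloor : |(fixedLog n j : ℝ) - 2 ^ n * ∑ i ∈ Finset.range n, x ^ (i + 1) / (i + 1)| ≤ n := by
    have hterm : ∀ i ∈ Finset.range n,
        |((2 ^ n / (j + 2) ^ (i + 1) / (i + 1) : ℕ) : ℝ) -
          2 ^ n * (x ^ (i + 1) / (i + 1))| ≤ 1 := by
      intro i _
      have := abs_natDiv_sub_le (2 ^ n) ((j + 2) ^ (i + 1) * (i + 1)) (by positivity)
      rw [Nat.div_div_eq_div_mul]
      convert this using 3
      rw [hx, one_div, inv_pow]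
      push_cast
      field_simp
    rw [fixedLog, Nat.cast_sum, Finset.mul_sum, ← Finset.sum_sub_distrib]
    refine (Finset.abs_sum_le_sum_abs _ _).trans ((Finset.sum_le_card_nsmul _ _ _ hterm).trans ?_)
    simp
  have h2 : (0 : ℝ) < 2 ^ n := by positivity
  have hsplit : (fixedLog n j : ℝ) / 2 ^ n - (Real.log (j + 2) - Real.log (j + 1)) =
      ((fixedLog n j : ℝ) - 2 ^ n * ∑ i ∈ Finset.range n, x ^ (i + 1) / (i + 1)) / 2 ^ n +
        (∑ i ∈ Finset.range n, x ^ (i + 1) / (i + 1) + Real.log (1 - x)) := by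
    rw [hlog]
    field_simp
    ring
  rw [hsplit, add_div]
  refine (abs_add_le _ _).trans (add_le_add ?_ htail)
  rw [abs_div, abs_of_pos h2]
  gcongr

/-- The increments telescope; `m = n - 1` yields `log n`. -/
lemma abs_sum_fixedLog_sub_le (n m : ℕ) :
    |((∑ j ∈ Finset.range m, fixedLog n j : ℕ) : ℝ) / 2 ^ n - Real.log (m + 1)| ≤
      m * ((n + 1) / 2 ^ n) := by
  have htel : Real.log (m + 1) = ∑ j ∈ Finset.range m, (Real.log (j + 2) - Real.log (j + 1)) := by
    have := Finset.sum_range_sub (fun j : ℕ => Real.log (j + 1)) m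
    simp only [Nat.cast_add, Nat.cast_one, Nat.cast_zero, zero_add, Real.log_one, sub_zero,
      add_assoc, one_add_one_eq_two] at this
    exact this.symm
  rw [htel, Nat.cast_sum, Finset.sum_div, ← Finset.sum_sub_distrib]
  refine (Finset.abs_sum_le_sum_abs _ _).trans ((Finset.sum_le_card_nsmul _ _ _ fun j _ =>
    abs_fixedLog_sub_le n j).trans ?_)
  simp

/-- The rate as a function of approximations to `log n`, `log 2` and the noise rate. -/
lemma abs_rate_sub_le {n a b p p' c δ : ℝ} (hn : 2 ≤ n) (hc : 0 < c) (hp : c ≤ 3 / 4 - p)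
    (hδ0 : 0 ≤ δ) (hδ : 8 * n * δ ≤ 1) (ha : |a - Real.log n| ≤ δ) (hb : |b - Real.log 2| ≤ δ)
    (hp0 : p' ≤ p) (hp1 : p - p' ≤ δ) :
    |4 * a ^ 2 / (n * b ^ 2 * (3 - 4 * p')) - 4 * Real.logb 2 n ^ 2 / (n * (3 - 4 * p))| ≤
      (40 / c + 4 / c ^ 2) * n * δ := by
  have hl2 := Real.log_two_gt_d9
  have hl2' := Real.log_two_lt_d9
  have hδ16 : δ ≤ 1 / 16 := by nlinarith
  have hb2 : 1 / 2 ≤ b := by linarith [(abs_le.1 hb).1]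
  have hln0 : 0 ≤ Real.log n := Real.log_nonneg (by linarith)
  have hln : Real.log n ≤ n - 1 := Real.log_le_sub_one_of_pos (by linarith)
  set t := Real.logb 2 n with ht
  have htdef : t = Real.log n / Real.log 2 := rfl
  have ht0 : 0 ≤ t := div_nonneg hln0 (by linarith)
  have ht2 : t ≤ 2 * n := by
    rw [htdef, div_le_iff₀ (by linarith)]
    nlinarith
  set t' := a / b with ht'
  have hb0 : 0 < b := by linarith
  have hl0 : 0 < Real.log 2 := by linarith
  have hdiff : |t' - t| ≤ 8 * n * δ := by
    have : t' - t = ((a - Real.log n) * Real.log 2 - (b - Real.log 2) * Real.log n) /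
        (b * Real.log 2) := by
      rw [ht', htdef]
      field_simp
      ring
    rw [this, abs_div, abs_of_pos (mul_pos hb0 hl0), div_le_iff₀ (mul_pos hb0 hl0)]
    have h1 : |(a - Real.log n) * Real.log 2 - (b - Real.log 2) * Real.log n| ≤
        δ * Real.log 2 + δ * Real.log n := by
      refine (abs_sub _ _).trans ?_
      rw [abs_mul, abs_mul, abs_of_pos hl0, abs_of_nonneg hln0]
      gcongr
    have h2 : 1 / 4 ≤ b * Real.log 2 := by nlinarith
    have h3 : δ * Real.log 2 + δ * Real.log n ≤ 2 * n * δ := by nlinarith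
    have h4 : 0 ≤ n * δ := by positivity
    nlinarith
  have hsq : |t' ^ 2 - t ^ 2| ≤ 40 * n ^ 2 * δ := by
    -- By `8 * n * δ ≤ 1`, `t'` differs from `t ≤ 2 * n` by at most 1.
    have h1 : |t' + t| ≤ 5 * n := by
      have := abs_le.1 hdiff
      rw [abs_le]
      constructor <;> linarith
    have : t' ^ 2 - t ^ 2 = (t' - t) * (t' + t) := by ring
    rw [this, abs_mul]
    calc |t' - t| * |t' + t| ≤ (8 * n * δ) * (5 * n) := by gcongr
      _ = 40 * n ^ 2 * δ := by ring
  have hs : 4 * c ≤ 3 - 4 * p := by linarith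
  have hs' : 4 * c ≤ 3 - 4 * p' := by linarith
  have hs0 : 0 < 3 - 4 * p := by linarith
  have hs0' : 0 < 3 - 4 * p' := by linarith
  have hn0 : 0 < n := by linarith
  -- The first term is the error from the logarithms, the second that from the truncated `p'`; they
  -- give `40 / c` and `4 / c ^ 2` respectively.
  have hexp : 4 * a ^ 2 / (n * b ^ 2 * (3 - 4 * p')) - 4 * t ^ 2 / (n * (3 - 4 * p)) =
      4 / n * ((t' ^ 2 - t ^ 2) / (3 - 4 * p') -
        t ^ 2 * (4 * (p - p')) / ((3 - 4 * p') * (3 - 4 * p))) := by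
    rw [ht']
    field_simp
    ring
  have hA : |(t' ^ 2 - t ^ 2) / (3 - 4 * p')| ≤ 40 * n ^ 2 * δ / (4 * c) := by
    rw [abs_div, abs_of_pos hs0']
    gcongr
  have hB : |t ^ 2 * (4 * (p - p')) / ((3 - 4 * p') * (3 - 4 * p))| ≤
      (2 * n) ^ 2 * (4 * δ) / ((4 * c) * (4 * c)) := by
    have h0 : 0 ≤ p - p' := by linarith
    rw [abs_of_nonneg (by positivity)]
    gcongr
  rw [hexp, abs_mul, abs_of_pos (by positivity)]
  calc 4 / n * |_| ≤ 4 / n * (40 * n ^ 2 * δ / (4 * c) +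
        (2 * n) ^ 2 * (4 * δ) / ((4 * c) * (4 * c))) := by
        gcongr
        exact (abs_sub _ _).trans (add_le_add hA hB)
    _ = (40 / c + 4 / c ^ 2) * n * δ := by
        field_simp
        ring

lemma tendsto_pow_mul_div_two_pow (C : ℝ) (k : ℕ) :
    Tendsto (fun n : ℕ => C * ((n : ℝ) ^ k / 2 ^ n)) atTop (nhds 0) := by
  simpa using (tendsto_pow_const_div_const_pow_of_one_lt k (by norm_num : (1 : ℝ) < 2)).const_mul C

lemma tendsto_logb_sq_div : Tendsto (fun n : ℕ => Real.logb 2 n ^ 2 / (n : ℝ)) atTop (nhds 0) := by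
  have h := (Real.tendsto_pow_log_div_mul_add_atTop 1 0 2 one_ne_zero).comp
    (tendsto_natCast_atTop_atTop (R := ℝ))
  have h2 := h.const_mul ((Real.log 2)⁻¹ ^ 2)
  rw [mul_zero] at h2
  refine h2.congr fun n => ?_
  simp only [Function.comp, Real.logb, one_mul, add_zero]
  ring

/-- The total noise rate of the reduction, for noise of rate `p` in the instance. -/
noncomputable def totalRate (n : ℕ) (p : ℝ) : ℝ :=
  p + depolRate n (noiseRate n ⌊2 ^ n * p⌋₊) - 4 * p * depolRate n (noiseRate n ⌊2 ^ n * p⌋₊) / 3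

lemma abs_totalRate_sub_le {n : ℕ} {p c δ : ℝ} (hn : 2 ≤ n) (hp0 : 0 < p) (hc : 0 < c)
    (hp : c ≤ 3 / 4 - p) (hδ : δ = (n : ℝ) ^ 2 / 2 ^ n) (hδ1 : 8 * n * δ ≤ 1)
    (hlog : Real.logb 2 n ^ 2 / n ≤ c) :
    |totalRate n p - (p + Real.logb 2 n ^ 2 / n)| ≤ (40 / c + 4 / c ^ 2 + 1) * n * δ := by
  have hnR : (2 : ℝ) ≤ n := by exact_mod_cast hn
  have hW : (0 : ℝ) < 2 ^ n := by positivity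
  set P := ⌊2 ^ n * p⌋₊ with hP
  set a : ℕ := ∑ j ∈ Finset.range (n - 1), fixedLog n j with ha
  set b := fixedLog n 0 with hb
  have hn1 : ((n - 1 : ℕ) : ℝ) = n - 1 := by rw [Nat.cast_sub (by omega)]; simp
  have ha' : |(a : ℝ) / 2 ^ n - Real.log n| ≤ δ := by
    have := abs_sum_fixedLog_sub_le n (n - 1)
    rw [hn1, sub_add_cancel] at this
    refine this.trans ?_
    rw [hδ, ← mul_div_assoc]
    gcongr
    nlinarith
  have hb' : |(b : ℝ) / 2 ^ n - Real.log 2| ≤ δ := by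
    have := abs_fixedLog_sub_le n 0
    rw [Nat.cast_zero, zero_add, zero_add, Real.log_one, sub_zero] at this
    refine this.trans ?_
    rw [hδ]
    gcongr
    nlinarith
  have hPle : (P : ℝ) ≤ 2 ^ n * p := Nat.floor_le (by positivity)
  have hPlt : 2 ^ n * p < P + 1 := Nat.lt_floor_add_one _
  have hp' : (P : ℝ) / 2 ^ n ≤ p := by rw [div_le_iff₀ hW]; linarith
  have h1δ : 1 / 2 ^ n ≤ δ := by rw [hδ]; gcongr; nlinarith
  have hp'' : p - (P : ℝ) / 2 ^ n ≤ δ := by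
    refine le_trans ?_ h1δ
    rw [sub_le_iff_le_add, ← add_div, le_div_iff₀ hW]
    linarith
  have hmain := abs_rate_sub_le hnR hc hp (by rw [hδ]; positivity) hδ1 ha' hb' hp' hp''
  -- The ideal value solves `l * (3 / 4 - p) = log₂² n / n`; then adding noise of rate `3 / 4 * l`
  -- reaches the target rate exactly.
  set l := 4 * Real.logb 2 n ^ 2 / (n * (3 - 4 * p)) with hl
  have hl1 : l ≤ 1 := by
    rw [hl, div_le_one (by apply mul_pos <;> linarith)]
    rw [div_le_iff₀ (by linarith)] at hlog
    nlinarith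
  have hδ16 : δ ≤ 1 / 16 := by
    have : 0 ≤ δ := by rw [hδ]; positivity
    nlinarith
  have hbpos : 0 < b := by
    have := (abs_le.1 hb').1
    have hl2 := Real.log_two_gt_d9
    have : (0 : ℝ) < (b : ℝ) / 2 ^ n := by linarith
    rw [lt_div_iff₀ hW, zero_mul] at this
    exact_mod_cast this
  have h34 : 4 * P < 3 * 2 ^ n := by
    have : (4 * P : ℝ) < 3 * 2 ^ n := by nlinarith
    exact_mod_cast this
  have hrate : |(noiseRate n P : ℝ) / 2 ^ n - l| ≤ (40 / c + 4 / c ^ 2) * n * δ + 1 / 2 ^ n := by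
    have hfl := abs_natDiv_sub_le (4 * 2 ^ n * 2 ^ n * (a * a))
      (n * (b * b) * (3 * 2 ^ n - 4 * P)) (by
        have : 0 < 3 * 2 ^ n - 4 * P := by omega
        positivity)
    have hsub : ((3 * 2 ^ n - 4 * P : ℕ) : ℝ) = 3 * 2 ^ n - 4 * P := by
      rw [Nat.cast_sub h34.le]; push_cast; ring
    have hX : ((4 * 2 ^ n * 2 ^ n * (a * a) : ℕ) : ℝ) /
        ((n * (b * b) * (3 * 2 ^ n - 4 * P) : ℕ) : ℝ) = 2 ^ n *
          (4 * ((a : ℝ) / 2 ^ n) ^ 2 /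
            (n * ((b : ℝ) / 2 ^ n) ^ 2 * (3 - 4 * ((P : ℝ) / 2 ^ n)))) := by
      rw [Nat.cast_mul (n * (b * b)), hsub]
      push_cast
      have h3 : (3 * 2 ^ n - 4 * P : ℝ) ≠ 0 := by
        have : (4 * P : ℝ) < 3 * 2 ^ n := by exact_mod_cast h34
        linarith
      have h4 : (3 - 4 * ((P : ℝ) / 2 ^ n)) = (3 * 2 ^ n - 4 * P) / 2 ^ n := by
        field_simp
      rw [h4]
      have hbR : (b : ℝ) ≠ 0 := by exact_mod_cast hbpos.ne'
      field_simp
    rw [hX] at hfl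
    set Y := 4 * ((a : ℝ) / 2 ^ n) ^ 2 / (n * ((b : ℝ) / 2 ^ n) ^ 2 * (3 - 4 * ((P : ℝ) / 2 ^ n)))
    have hrw : (noiseRate n P : ℝ) / 2 ^ n - l =
        (Y - l) + ((noiseRate n P : ℝ) - 2 ^ n * Y) / 2 ^ n := by
      field_simp
      ring
    rw [hrw]
    refine (abs_add_le _ _).trans (add_le_add hmain ?_)
    rw [abs_div, abs_of_pos hW]
    gcongr
    exact hfl
  -- Since `l ≤ 1`, the cutoff at `2 ^ n`, being 1-Lipschitz, does not increase the error.
  have hmin : |((min (noiseRate n P) (2 ^ n) : ℕ) : ℝ) / 2 ^ n - l| ≤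
      (40 / c + 4 / c ^ 2) * n * δ + 1 / 2 ^ n := by
    refine le_trans ?_ hrate
    have hcast : ((min (noiseRate n P) (2 ^ n) : ℕ) : ℝ) / 2 ^ n =
        min ((noiseRate n P : ℝ) / 2 ^ n) 1 := by
      rw [Nat.cast_min, ← min_div_div_right hW.le]
      push_cast
      rw [div_self hW.ne']
    have h := abs_min_sub_min_le_max ((noiseRate n P : ℝ) / 2 ^ n) 1 l 1
    rw [min_eq_left hl1, sub_self, abs_zero, max_eq_left (abs_nonneg _)] at h
    rwa [hcast]
  have hq : totalRate n p - (p + Real.logb 2 n ^ 2 / n) =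
      (((min (noiseRate n P) (2 ^ n) : ℕ) : ℝ) / 2 ^ n - l) * (3 / 4 - p) := by
    have h3 : 3 - 4 * p ≠ 0 := by linarith
    have hn0 : (n : ℝ) ≠ 0 := by linarith
    have hlp : l * (3 / 4 - p) = Real.logb 2 n ^ 2 / n := by
      rw [hl, show 3 / 4 - p = (3 - 4 * p) / 4 by ring]
      field_simp
    rw [sub_mul, hlp, totalRate, depolRate, ← hP]
    ring
  rw [hq, abs_mul, abs_of_pos (by linarith : 0 < 3 / 4 - p)]
  have hbound : (40 / c + 4 / c ^ 2) * n * δ + 1 / 2 ^ n ≤ (40 / c + 4 / c ^ 2 + 1) * n * δ := by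
    have : δ ≤ n * δ := by
      have : 0 ≤ δ := by rw [hδ]; positivity
      nlinarith
    linarith
  refine le_trans ?_ hbound
  exact (mul_le_of_le_one_right (abs_nonneg _) (by linarith)).trans hmin

/-- The noise rate that the reduction achieves is superpolynomially close to the target rate. -/
lemma eventually_pow_mul_abs_totalRate_sub_le {p : ℕ → ℝ} (hp : ∀ n, 0 < p n) {c : ℝ} (hc : 0 < c)
    (hpc : ∀ᶠ n in atTop, c ≤ 3 / 4 - p n) (k : ℕ) :
    ∀ᶠ n : ℕ in atTop, (n : ℝ) ^ k *
      |totalRate n (p n) - (p n + Real.logb 2 n ^ 2 / n)| ≤ 1 := by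
  have h1 := (tendsto_pow_mul_div_two_pow 8 3).eventually_le_const one_pos
  have h2 := (tendsto_pow_mul_div_two_pow (40 / c + 4 / c ^ 2 + 1) (k + 3)).eventually_le_const
    one_pos
  have h3 := tendsto_logb_sq_div.eventually_le_const hc
  filter_upwards [h1, h2, h3, hpc, eventually_ge_atTop 2] with n h1 h2 h3 h4 hn
  refine le_trans ?_ h2
  have := abs_totalRate_sub_le hn (hp n) hc h4 rfl (by
    refine le_trans (le_of_eq ?_) h1
    ring) h3
  calc _ ≤ (n : ℝ) ^ k * ((40 / c + 4 / c ^ 2 + 1) * n * ((n : ℝ) ^ 2 / 2 ^ n)) := by gcongr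
    _ = _ := by ring

end Reduction

/-! ## Continuity in the noise rate -/

/-- A lower bound `ρ` on the likelihood ratio of a single pair becomes `ρ ^ n` for `n` independent
pairs. -/
lemma depolarizing_le_of_le {n : ℕ} {q q' ρ : ℝ} (hρ : 0 ≤ ρ) (hq0 : 0 ≤ q) (hq1 : q ≤ 1)
    (h0 : ρ * q ≤ q') (h1 : ρ * (1 - q) ≤ 1 - q') (e : Vec n) :
    ρ ^ n * depolarizing q e ≤ depolarizing q' e := by
  have : ρ ^ n = ∏ _i : Fin n, ρ := by simp
  rw [this, depolarizing_eq, depolarizing_eq, ← Finset.prod_mul_distrib]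
  refine Finset.prod_le_prod (fun i _ => mul_nonneg hρ ?_) fun i _ => ?_
  · rw [pairWeight]
    split_ifs <;> linarith
  · rw [pairWeight, pairWeight]
    split_ifs
    · exact h1
    · linarith

lemma structuredProb_mem_Icc {n k : ℕ} {q : ℝ} (hq0 : 0 ≤ q) (hq1 : q ≤ 1)
    {D : Mat n k → Vec n → ℝ} (hD : ∀ A u, D A u ∈ Set.Icc (0 : ℝ) 1) :
    structuredProb k n q D ∈ Set.Icc (0 : ℝ) 1 := by
  have hin : ∀ A x, ∑ e : Vec n, depolarizing q e * D A (A.mulVec x + e) ∈ Set.Icc (0 : ℝ) 1 := by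
    intro A x
    refine ⟨Finset.sum_nonneg fun e _ => mul_nonneg (depolarizing_nonneg hq0 hq1 e) (hD _ _).1, ?_⟩
    rw [← sum_depolarizing (n := n) q]
    exact Finset.sum_le_sum fun e _ =>
      mul_le_of_le_one_right (depolarizing_nonneg hq0 hq1 e) (hD _ _).2
  refine ⟨Finset.expect_nonneg fun A _ => Finset.expect_nonneg fun x _ => (hin A x).1, ?_⟩
  rcases (codes n k).eq_empty_or_nonempty with h | h
  · simp [structuredProb, h]
  · exact Finset.expect_le h fun A _ => Finset.expect_le Finset.univ_nonempty fun x _ =>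
      (hin A x).2

lemma mul_structuredProb_le {n k : ℕ} {q q' ρ : ℝ} (hρ : 0 ≤ ρ) (hq0 : 0 ≤ q) (hq1 : q ≤ 1)
    (h0 : ρ * q ≤ q') (h1 : ρ * (1 - q) ≤ 1 - q') {D : Mat n k → Vec n → ℝ}
    (hD : ∀ A u, 0 ≤ D A u) :
    ρ ^ n * structuredProb k n q D ≤ structuredProb k n q' D := by
  simp only [structuredProb, Finset.mul_expect, Finset.mul_sum]
  refine Finset.expect_le_expect fun A _ => Finset.expect_le_expect fun x _ =>
    Finset.sum_le_sum fun e _ => ?_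
  rw [← mul_assoc]
  exact mul_le_mul_of_nonneg_right (depolarizing_le_of_le hρ hq0 hq1 h0 h1 e) (hD _ _)

lemma structuredProb_one_sub {n k : ℕ} (q : ℝ) (D : Mat n k → Vec n → ℝ)
    (h : (codes n k).Nonempty) :
    structuredProb k n q (fun A u => 1 - D A u) = 1 - structuredProb k n q D := by
  simp only [structuredProb, mul_sub, mul_one, Finset.sum_sub_distrib, sum_depolarizing,
    Finset.expect_sub_distrib, Finset.expect_const h, Finset.expect_const Finset.univ_nonempty]

/-- A small change of the noise rate has a small effect. -/
lemma abs_structuredProb_sub_le {n k : ℕ} {q q' η : ℝ} (hη0 : 0 ≤ η) (hη1 : η ≤ 1) (hq0 : 0 ≤ q)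
    (hq1 : q ≤ 1) (h0 : (1 - η) * q ≤ q') (h1 : (1 - η) * (1 - q) ≤ 1 - q')
    {D : Mat n k → Vec n → ℝ} (hD : ∀ A u, D A u ∈ Set.Icc (0 : ℝ) 1) :
    |structuredProb k n q' D - structuredProb k n q D| ≤ n * η := by
  -- Without codes both averages are 0 by convention.
  rcases (codes n k).eq_empty_or_nonempty with h | h
  · simp only [structuredProb, h, Finset.expect_empty, sub_self, abs_zero]
    positivity
  have hpow : 1 - n * η ≤ (1 - η) ^ n := by
    have := one_add_mul_le_pow (a := -η) (by linarith) n
    simpa [sub_eq_add_neg] using this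
  -- Domination only yields a lower bound, `(1 - η) ^ n ≥ 1 - n * η`; applying it to `D` and to `1 -
  -- D` gives both sides.
  have key : ∀ E : Mat n k → Vec n → ℝ, (∀ A u, E A u ∈ Set.Icc (0 : ℝ) 1) →
      structuredProb k n q E - n * η ≤ structuredProb k n q' E := by
    intro E hE
    have hmem := structuredProb_mem_Icc hq0 hq1 hE
    have := mul_structuredProb_le (by linarith) hq0 hq1 h0 h1 fun A u => (hE A u).1
    have h2 := mul_le_mul_of_nonneg_right hpow hmem.1
    have h3 : n * η * structuredProb k n q E ≤ n * η :=
      mul_le_of_le_one_right (by positivity) hmem.2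
    linarith
  have hlow := key D hD
  have hupp := key (fun A u => 1 - D A u) fun A u =>
    ⟨by linarith [(hD A u).2], by linarith [(hD A u).1]⟩
  rw [structuredProb_one_sub _ _ h, structuredProb_one_sub _ _ h] at hupp
  rw [abs_le]
  constructor <;> linarith

/-! ### The reduction solves the decision problem -/

namespace Reduction

lemma acceptProb_mem_Icc (M : OneCallAlgorithm) {n P : ℕ} {O : Mat n (n - 1) → Vec n → ℝ}
    (hO : ∀ A u, O A u ∈ Set.Icc (0 : ℝ) 1) (A : Mat n n) (u : Vec n) :
    M.acceptProb n P O A u ∈ Set.Icc (0 : ℝ) 1 := by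
  have hout : ∀ r b, M.output n P A u r b ∈ Set.Icc (0 : ℝ) 1 := by
    intro r b
    rw [OneCallAlgorithm.output]
    split_ifs <;> simp
  refine ⟨Finset.expect_nonneg fun r _ => ?_, Finset.expect_le Finset.univ_nonempty fun r _ => ?_⟩
  all_goals
    have hq := hO (readMat (M.atCall n P A u r) 5 n (n - 1)) (readVec (M.atCall n P A u r) 6 n)
    have h1 := hout r true
    have h2 := hout r false
    simp only [Set.mem_Icc] at hq h1 h2
    nlinarith

lemma solves_algorithm {p : ℕ → ℝ} (hp : ∀ n, 0 < p n ∧ p n < 1) {c : ℝ} (hc : 0 < c)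
    (hpc : ∀ᶠ n : ℕ in atTop, c ≤ 3 / 4 - p n) {O : (n : ℕ) → Mat n (n - 1) → Vec n → ℝ}
    (hO : Solves (fun n => n - 1) (fun n => p n + Real.logb 2 n ^ 2 / n) O) :
    Solves (fun n => n) p (algorithm.withOracle p O) := by
  obtain ⟨hO1, k, hk⟩ := hO
  refine ⟨fun n A u => acceptProb_mem_Icc _ (hO1 n) A u, k + 1, ?_⟩
  -- The rate error `Δ` enters the advantage as `n ^ 2 * Δ`, which has to stay below `1 / n ^ (k +
  -- 1)`.
  have hclose := eventually_pow_mul_abs_totalRate_sub_le (fun n => (hp n).1) hc hpc (k + 3)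
  have hlog := tendsto_logb_sq_div.eventually_le_const hc
  filter_upwards [hk, hclose, hlog, hpc, eventually_ge_atTop 8] with n hk hclose hlog hpc hn
  obtain ⟨m, rfl⟩ : ∃ m, n = m + 1 := ⟨n - 1, by omega⟩
  set n := m + 1 with hnm
  have hnR : (8 : ℝ) ≤ n := by exact_mod_cast hn
  have hn0 : (0 : ℝ) < n := by linarith
  have hpn := hp n
  set q := p n + Real.logb 2 n ^ 2 / n with hq
  set q' := totalRate n (p n) with hq'
  have hadv : advantage n n (p n) (algorithm.withOracle p O n) =
      advantage m n q' (O n) / 4 :=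
    advantage_algorithm (by omega) ⌊2 ^ n * p n⌋₊ (p n) (O n) rfl
  have hlog1 : 1 ≤ Real.logb 2 n := by
    rw [Real.le_logb_iff_rpow_le one_lt_two hn0, Real.rpow_one]
    linarith
  have hqn : 1 / n ≤ q := by
    have h1 : 1 / (n : ℝ) ≤ Real.logb 2 n ^ 2 / n := by
      gcongr
      nlinarith
    linarith
  have hq34 : q ≤ 3 / 4 := by linarith
  have h1n : 1 / (n : ℝ) ≤ 1 / 8 := one_div_le_one_div_of_le (by norm_num) hnR
  set Δ := |q' - q| with hΔ
  have hΔ0 : 0 ≤ Δ := abs_nonneg _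
  have hpow1 : (1 : ℝ) ≤ (n : ℝ) ^ (k + 2) := one_le_pow₀ (by linarith)
  have hη1 : n * Δ ≤ 1 := by
    refine le_trans ?_ hclose
    rw [show k + 3 = (k + 2) + 1 by ring, pow_succ, mul_assoc]
    exact le_mul_of_one_le_left (by positivity) hpow1
  -- Both `q` and `1 - q` are at least `1 / n`: the former thanks to the added noise, the latter
  -- because `q ≤ 3/4`. Hence `n * Δ` bounds the relative change of both.
  have hnq : Δ ≤ n * Δ * q := by
    have : n * (1 / n) * Δ ≤ n * q * Δ := by gcongr
    rw [mul_one_div_cancel hn0.ne'] at this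
    linarith
  have hnq' : Δ ≤ n * Δ * (1 - q) := by
    have : n * (1 / n) * Δ ≤ n * (1 - q) * Δ := by
      gcongr
      linarith
    rw [mul_one_div_cancel hn0.ne'] at this
    linarith
  have habs := abs_le.1 (le_of_eq hΔ.symm)
  have hstruct := abs_structuredProb_sub_le (n := n) (k := m) (q := q) (q' := q') (η := n * Δ)
    (by positivity) hη1 (le_trans (by positivity) hqn) (by linarith) (by nlinarith)
    (by nlinarith) (hO1 n)
  have hk' : 1 / (n : ℝ) ^ k ≤ advantage m n q (O n) := hk
  have hle : advantage m n q (O n) ≤ advantage m n q' (O n) + n * (n * Δ) := by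
    have := abs_sub_abs_le_abs_sub (structuredProb m n q (O n) - unstructuredProb m n (O n))
      (structuredProb m n q' (O n) - unstructuredProb m n (O n))
    rw [sub_sub_sub_cancel_right, abs_sub_comm (structuredProb m n q (O n))
      (structuredProb m n q' (O n))] at this
    unfold advantage
    linarith
  have hsmall : n * (n * Δ) ≤ 1 / (n : ℝ) ^ (k + 1) := by
    rw [le_div_iff₀ (by positivity)]
    calc n * (n * Δ) * (n : ℝ) ^ (k + 1) = (n : ℝ) ^ (k + 3) * Δ := by ring
      _ ≤ 1 := hclose
  -- Of the five parts, one pays for the rate error and four for the factor 1/4 in the advantage.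
  have hfin : 5 / (n : ℝ) ^ (k + 1) ≤ 1 / (n : ℝ) ^ k := by
    rw [div_le_div_iff₀ (by positivity) (by positivity), pow_succ, one_mul, mul_comm]
    gcongr
    linarith
  have hfive : 5 / (n : ℝ) ^ (k + 1) = 5 * (1 / (n : ℝ) ^ (k + 1)) := by ring
  change _ ≤ advantage n n (p n) (algorithm.withOracle p O n)
  rw [hadv]
  linarith

end Reduction

end SympLPN

theorem mainTheorem2 :
    ∃ M : SympLPN.OneCallAlgorithm, M.IsPolyTime ∧
      ∀ p : ℕ → ℝ, (∀ n, 0 < p n ∧ p n < 1) →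
        (∃ c : ℝ, 0 < c ∧ ∀ᶠ n : ℕ in Filter.atTop, c ≤ 3 / 4 - p n) →
        ∀ O : (n : ℕ) → SympLPN.Mat n (n - 1) → SympLPN.Vec n → ℝ,
          SympLPN.Solves (fun n => n - 1) (fun n => p n + Real.logb 2 n ^ 2 / n) O →
            SympLPN.Solves (fun n => n) p (M.withOracle p O) :=
  ⟨SympLPN.Reduction.algorithm, SympLPN.Reduction.isPolyTime_algorithm,
    fun _ hp ⟨_, hc, hpc⟩ _ hO => SympLPN.Reduction.solves_algorithm hp hc hpc hO⟩
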